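/- Let $d>2$ be a real number, let $U\subseteq\mathbf{R}^3$ be open, and let $f:U\to\mathbf{R}$ be a smooth function that is homogeneous of degree $d$, i.e. $f(\lambda x)=\lambda^d f(x)$ whenever $\lambda>0$ and $x,\lambda x\in U$. Write $f_{ij}$, $f_{ijk}$ for the second and third partial derivatives of $f$, and suppose that the Hessian determinant $H(f)=\det(f_{ij})$ is nonzero on $U$. Give $U$ the pseudo-Riemannian metric $$g_{ij}=-\frac{1}{d(d-1)}\frac{\partial^2 f}{\partial x_i\partial x_j},$$ and give $M=\{x\in U: f(x)=1\}$ the restricted metric. Let $S(f)$ be the Clebsch covariant $$\begin{aligned} S(f)={}&-(a_0a_2-a_1^2)c_1^2+(a_0a_3-a_1a_2)c_0c_1-(a_1a_3-a_2^2)c_0^2-b_0^2a_3c_1+b_0b_1(3a_2c_1+a_3c_0)\\ &-(b_0b_2+2b_1^2)(a_1c_1+a_2c_0)+b_1b_2(a_0c_1+3a_1c_0)-b_2^2a_0c_0\\ &+d_0[b_0(a_1a_3-a_2^2)-b_1(a_0a_3-a_1a_2)+b_2(a_0a_2-a_1^2)]+(b_0b_2-b_1^2)^2, \end{aligned}$$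 where $a_0=f_{111}$, $a_1=f_{113}$, $a_2=f_{133}$, $a_3=f_{333}$, $b_0=f_{112}$, $b_1=f_{123}$, $b_2=f_{233}$, $c_0=f_{122}$, $c_1=f_{223}$, $d_0=f_{222}$. Then at every point of $M$ the following holds. The set $M$ is a smooth surface near the point, with tangent plane $\ker df$, and the metric is nondegenerate on this plane. The sectional curvature of $U$ on the tangent plane to $M$ is $$K=\frac{d^2(d-1)^2}{4(d-2)^2}\,\frac{S(f)\,f}{H(f)^2},$$ and the sectional curvature of the surface $M$ is $$K_M=-\frac{d^2}{4}+\frac{d^2(d-1)^2}{4(d-2)^2}\,\frac{S(f)\,f^2}{H(f)^2}.$$ Sectional curvature is normalized so that round spheres have positive curvature. -/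

import Mathlib

open scoped ContDiff

namespace HessianCurv

noncomputable section

/-- The partial derivative `∂F/∂x_i`, as a function on `ℝ^ι`. -/
def pderiv {ι : Type*} [Fintype ι] [DecidableEq ι] (i : ι) (F : (ι → ℝ) → ℝ) : (ι → ℝ) → ℝ :=
  fun x => fderiv ℝ F x (Pi.single i 1)

/-! ### Curvature of a pseudo-Riemannian metric in coordinates

A metric is a function `g` sending a point of `ℝ^ι` to its Gram matrix in the coordinate frame.
Everything below depends only on the germ of `g` at the point considered. -/

/-- Christoffel symbols of the first kind,
`Γ_{ijk} = (g_{ij,k} + g_{jk,i} - g_{ik,j}) / 2`, where `j` is the lowered index. -/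
def christoffel {ι : Type*} [Fintype ι] [DecidableEq ι] (g : (ι → ℝ) → Matrix ι ι ℝ)
    (x : ι → ℝ) (i j k : ι) : ℝ :=
  (1 / 2) * (pderiv k (fun y => g y i j) x + pderiv i (fun y => g y j k) x
    - pderiv j (fun y => g y i k) x)

/-- The Riemann curvature tensor with all indices lowered, for any pseudo-Riemannian metric:
`R_{ijkl} = -(g_{ik,jl} + g_{jl,ik} - g_{il,jk} - g_{jk,il}) / 2
  - ∑_{p,q} g^{pq} (Γ_{jpl} Γ_{iqk} - Γ_{ipl} Γ_{jqk})`.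
In this sign convention `R_{1212} > 0` on a round sphere. -/
def riemann {ι : Type*} [Fintype ι] [DecidableEq ι] (g : (ι → ℝ) → Matrix ι ι ℝ)
    (x : ι → ℝ) (i j k l : ι) : ℝ :=
  -(1 / 2) * (pderiv l (pderiv j (fun y => g y i k)) x + pderiv k (pderiv i (fun y => g y j l)) x
      - pderiv k (pderiv j (fun y => g y i l)) x - pderiv l (pderiv i (fun y => g y j k)) x)
    - ∑ p, ∑ q, (g x)⁻¹ p q *
        (christoffel g x j p l * christoffel g x i q k
          - christoffel g x i p l * christoffel g x j q k)

/-- The inner product `⟨u, v⟩ = ∑ g_{ij} u_i v_j` at `x`. -/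
def metricInner {ι : Type*} [Fintype ι] (g : (ι → ℝ) → Matrix ι ι ℝ)
    (x u v : ι → ℝ) : ℝ :=
  ∑ i, ∑ j, g x i j * u i * v j

/-- The Gram determinant `⟨u,u⟩⟨v,v⟩ - ⟨u,v⟩²` of two tangent vectors at `x`. -/
def gramDet {ι : Type*} [Fintype ι] (g : (ι → ℝ) → Matrix ι ι ℝ)
    (x u v : ι → ℝ) : ℝ :=
  metricInner g x u u * metricInner g x v v - metricInner g x u v ^ 2

/-- The quotient `R(u,v,u,v) / (⟨u,u⟩⟨v,v⟩ - ⟨u,v⟩²)`, which is the sectional curvature of the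
plane spanned by `u` and `v` when that plane is nondegenerate. -/
def sectionalQuotient {ι : Type*} [Fintype ι] [DecidableEq ι] (g : (ι → ℝ) → Matrix ι ι ℝ)
    (x u v : ι → ℝ) : ℝ :=
  (∑ i, ∑ j, ∑ k, ∑ l, riemann g x i j k l * u i * v j * u k * v l) / gramDet g x u v

/-- `P` is a nondegenerate 2-plane of tangent vectors at `x`, and the sectional curvature of the
metric `g` on it is `K`. -/
def HasSectionalCurvature {ι : Type*} [Fintype ι] [DecidableEq ι] (g : (ι → ℝ) → Matrix ι ι ℝ)
    (x : ι → ℝ) (P : Submodule ℝ (ι → ℝ)) (K : ℝ) : Prop :=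
  Module.finrank ℝ P = 2 ∧
    ∀ u ∈ P, ∀ v ∈ P, LinearIndependent ℝ ![u, v] →
      gramDet g x u v ≠ 0 ∧ sectionalQuotient g x u v = K

/-! ### Surfaces in an open subset of `ℝ^3`, with the induced metric -/

/-- `φ : V → M` is a smooth local parametrization of the surface `M ⊆ ℝ^3` around `x = φ p`:
an immersion of an open set `V ⊆ ℝ^2` that is a homeomorphism onto an open subset of `M`. -/
structure IsLocalParametrization (M : Set (Fin 3 → ℝ)) (x : Fin 3 → ℝ) (V : Set (Fin 2 → ℝ))
    (φ : (Fin 2 → ℝ) → (Fin 3 → ℝ)) (p : Fin 2 → ℝ) : Prop where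
  isOpen : IsOpen V
  mem : p ∈ V
  map_eq : φ p = x
  smooth : ContDiffOn ℝ ∞ φ V
  immersion : ∀ q ∈ V, Function.Injective (fderiv ℝ φ q)
  embedding : Topology.IsEmbedding (V.domRestrict φ)
  image : ∃ W : Set (Fin 3 → ℝ), IsOpen W ∧ φ '' V = M ∩ W

/-- The metric induced by `g` through the parametrization `φ`, in the coordinates of `ℝ^2`:
its entries are `⟨∂φ/∂s_a, ∂φ/∂s_b⟩`. -/
def inducedMetric (g : (Fin 3 → ℝ) → Matrix (Fin 3) (Fin 3) ℝ)
    (φ : (Fin 2 → ℝ) → (Fin 3 → ℝ)) : (Fin 2 → ℝ) → Matrix (Fin 2) (Fin 2) ℝ :=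
  fun s => Matrix.of fun a b =>
    metricInner g (φ s) (fderiv ℝ φ s (Pi.single a 1)) (fderiv ℝ φ s (Pi.single b 1))

/-- `M` is a smooth surface near `x`, the restriction of `g` to it is nondegenerate at `x`, and
the (intrinsic) sectional curvature of this restricted metric at `x` is `K`. -/
def HasSurfaceCurvature (g : (Fin 3 → ℝ) → Matrix (Fin 3) (Fin 3) ℝ)
    (M : Set (Fin 3 → ℝ)) (x : Fin 3 → ℝ) (K : ℝ) : Prop :=
  (∃ V φ p, IsLocalParametrization M x V φ p) ∧
    ∀ V φ p, IsLocalParametrization M x V φ p →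
      HasSectionalCurvature (inducedMetric g φ) p ⊤ K

/-! ### Homogeneous functions, the Hessian metric, and the covariants -/

/-- `f` is (positively) homogeneous of real degree `d` on `U`. -/
def IsHomogeneousOn (d : ℝ) (f : (Fin 3 → ℝ) → ℝ) (U : Set (Fin 3 → ℝ)) : Prop :=
  ∀ x ∈ U, ∀ t : ℝ, 0 < t → t • x ∈ U → f (t • x) = t ^ d * f x

/-- The Hessian matrix `(∂²f/∂x_i∂x_j)`. -/
def hessian (f : (Fin 3 → ℝ) → ℝ) (x : Fin 3 → ℝ) : Matrix (Fin 3) (Fin 3) ℝ :=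
  Matrix.of fun i j => pderiv i (pderiv j f) x

/-- The Hessian determinant `H(f)`. -/
def hessianDet (f : (Fin 3 → ℝ) → ℝ) (x : Fin 3 → ℝ) : ℝ := (hessian f x).det

/-- The Hessian metric `-1/(d(d-1)) ∂²f/∂x_i∂x_j`. -/
def hessianMetric (d : ℝ) (f : (Fin 3 → ℝ) → ℝ) (x : Fin 3 → ℝ) : Matrix (Fin 3) (Fin 3) ℝ :=
  (-1 / (d * (d - 1))) • hessian f x

/-- The third partial derivative `∂³f/∂x_i∂x_j∂x_k`. -/
def third (f : (Fin 3 → ℝ) → ℝ) (x : Fin 3 → ℝ) (i j k : Fin 3) : ℝ :=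
  pderiv i (pderiv j (pderiv k f)) x

/-- The Clebsch covariant `S(f)`: the Aronhold invariant of ternary cubics with its coefficients
replaced by the third derivatives of `f`. The variables `x_1, x_2, x_3` have indices `0, 1, 2`. -/
def clebsch (f : (Fin 3 → ℝ) → ℝ) (x : Fin 3 → ℝ) : ℝ :=
  let a₀ := third f x 0 0 0
  let a₁ := third f x 0 0 2
  let a₂ := third f x 0 2 2
  let a₃ := third f x 2 2 2
  let b₀ := third f x 0 0 1
  let b₁ := third f x 0 1 2
  let b₂ := third f x 1 2 2
  let c₀ := third f x 0 1 1
  let c₁ := third f x 1 1 2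
  let d₀ := third f x 1 1 1;
  -(a₀ * a₂ - a₁ ^ 2) * c₁ ^ 2 + (a₀ * a₃ - a₁ * a₂) * c₀ * c₁ - (a₁ * a₃ - a₂ ^ 2) * c₀ ^ 2
    - b₀ ^ 2 * a₃ * c₁ + b₀ * b₁ * (3 * a₂ * c₁ + a₃ * c₀)
    - (b₀ * b₂ + 2 * b₁ ^ 2) * (a₁ * c₁ + a₂ * c₀) + b₁ * b₂ * (a₀ * c₁ + 3 * a₁ * c₀)
    - b₂ ^ 2 * a₀ * c₀
    + d₀ * (b₀ * (a₁ * a₃ - a₂ ^ 2) - b₁ * (a₀ * a₃ - a₁ * a₂) + b₂ * (a₀ * a₂ - a₁ ^ 2))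
    + (b₀ * b₂ - b₁ ^ 2) ^ 2

end

end HessianCurv

open HessianCurv

/-! Put c = -1/(d(d-1)), so that the metric is g = cH with H the Hessian; let ν = df and let T be
the third derivatives of f. The first derivatives of g are cT, totally symmetric. So the first-kind
Christoffel symbols are cT/2, the fourth derivatives of f cancel from the curvature, and R(u,v,u,v)
= -(c/4)Q with Q = H⁻¹(T(u,u,·), T(v,v,·)) - H⁻¹(T(u,v,·), T(u,v,·)).

Where f = 1, Euler's relations read ν(x) = d, Hx = (d-1)ν, T(·,·,x) = (d-2)H. In a frame (u, v, x)
with u, v in ker ν, the matrix of H is therefore block diagonal, and every coefficient of T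
involving x is known from H. The Aronhold invariant has weight four (`aronhold_pull`), so it may be
evaluated in this frame, where it becomes (d-2)²d(d-1)·gram·Q. The determinant of H in the frame is
d(d-1)·gram, which gives nondegeneracy of the tangent plane, and the two together give Q/gram
(`dualForm_sub_div_gram`), hence K.

For the surface, x is normal to M with ⟨x,x⟩ = -1. For a parametrization φ, the ambient covariant
derivative of φ_b along φ_a, with index lowered, is c(Hφ_ab + T(φ_a,φ_b,·)/2). Differentiating f∘φ =
1 twice shows that its value on x is -(d/2)g(φ_a,φ_b). So M is umbilic, and the Gauss equation with
a normal of square -1 gives K_M = K - d²/4. `gauss_algebra` and `riemann_inducedMetric` carry this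
out in coordinates. -/

namespace HessianCurv

/-! ### Partial derivatives of smooth functions -/

section Calculus

variable {ι κ : Type*} [Fintype ι] [DecidableEq ι] [Fintype κ] [DecidableEq κ]
  {U : Set (ι → ℝ)} {F G : (ι → ℝ) → ℝ} {x : ι → ℝ}

theorem contDiffOn_pderiv (hU : IsOpen U) (hF : ContDiffOn ℝ ∞ F U) (i : ι) :
    ContDiffOn ℝ ∞ (pderiv i F) U :=
  (hF.fderiv_of_isOpen hU (by simp)).clm_apply contDiffOn_const

omit [DecidableEq ι] in
theorem differentiableAt_of_contDiffOn (hU : IsOpen U) (hF : ContDiffOn ℝ ∞ F U) (hx : x ∈ U) :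
    DifferentiableAt ℝ F x :=
  (hF.contDiffAt (hU.mem_nhds hx)).differentiableAt (by simp)

theorem eqOn_pderiv (hU : IsOpen U) (h : Set.EqOn F G U) (i : ι) :
    Set.EqOn (pderiv i F) (pderiv i G) U := fun x hx => by
  unfold pderiv
  rw [(h.eventuallyEq_of_mem (hU.mem_nhds hx)).fderiv_eq]

theorem pderiv_const (i : ι) (c : ℝ) (x : ι → ℝ) : pderiv i (fun _ => c) x = 0 := by
  simp [pderiv]

theorem pderiv_add (hF : DifferentiableAt ℝ F x) (hG : DifferentiableAt ℝ G x) (i : ι) :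
    pderiv i (fun y => F y + G y) x = pderiv i F x + pderiv i G x := by
  simp [pderiv, fderiv_fun_add hF hG]

theorem pderiv_sub (hF : DifferentiableAt ℝ F x) (hG : DifferentiableAt ℝ G x) (i : ι) :
    pderiv i (fun y => F y - G y) x = pderiv i F x - pderiv i G x := by
  simp [pderiv, fderiv_fun_sub hF hG]

theorem pderiv_const_mul (hF : DifferentiableAt ℝ F x) (c : ℝ) (i : ι) :
    pderiv i (fun y => c * F y) x = c * pderiv i F x := by
  simp [pderiv, fderiv_const_mul hF]

theorem pderiv_mul (hF : DifferentiableAt ℝ F x) (hG : DifferentiableAt ℝ G x) (i : ι) :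
    pderiv i (fun y => F y * G y) x = pderiv i F x * G x + F x * pderiv i G x := by
  simp [pderiv, fderiv_fun_mul hF hG]; ring

theorem pderiv_sum {α : Type*} (s : Finset α) {A : α → (ι → ℝ) → ℝ}
    (hA : ∀ a, DifferentiableAt ℝ (A a) x) (i : ι) :
    pderiv i (fun y => ∑ a ∈ s, A a y) x = ∑ a ∈ s, pderiv i (A a) x := by
  simp [pderiv, fderiv_fun_sum (fun a _ => hA a)]

theorem pderiv_apply (i j : ι) (x : ι → ℝ) :
    pderiv i (fun y => y j) x = if i = j then 1 else 0 := by
  have : HasFDerivAt (fun y : ι → ℝ => y j) (ContinuousLinearMap.proj (R := ℝ) (φ := fun _ => ℝ) j) x :=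
    ContinuousLinearMap.hasFDerivAt (ContinuousLinearMap.proj (R := ℝ) (φ := fun _ => ℝ) j)
  simp [pderiv, this.fderiv, Pi.single_apply, eq_comm]

theorem fderiv_eq_sum_pderiv (x v : ι → ℝ) : fderiv ℝ F x v = ∑ i, pderiv i F x * v i := by
  conv_lhs => rw [pi_eq_sum_univ' v]
  simp [pderiv, map_sum, mul_comm]

theorem pderiv_comp {φ : (κ → ℝ) → (ι → ℝ)} {s : κ → ℝ} (hF : DifferentiableAt ℝ F (φ s))
    (hφ : DifferentiableAt ℝ φ s) (a : κ) :
    pderiv a (fun t => F (φ t)) s =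
      ∑ i, pderiv i F (φ s) * pderiv a (fun t => φ t i) s := by
  have h1 : pderiv a (fun t => F (φ t)) s = fderiv ℝ F (φ s) (fderiv ℝ φ s (Pi.single a 1)) := by
    have := fderiv_comp (𝕜 := ℝ) s hF hφ
    unfold pderiv
    change fderiv ℝ (F ∘ φ) s _ = _
    rw [this]; rfl
  rw [h1, fderiv_eq_sum_pderiv]
  refine Finset.sum_congr rfl fun i _ => ?_
  congr 1
  unfold pderiv
  rw [fderiv_apply hφ]
  rfl

theorem pderiv_comm (hU : IsOpen U) (hF : ContDiffOn ℝ ∞ F U) (hx : x ∈ U) (i j : ι) :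
    pderiv i (pderiv j F) x = pderiv j (pderiv i F) x := by
  have hc : ContDiffAt ℝ ∞ F x := hF.contDiffAt (hU.mem_nhds hx)
  have hd : DifferentiableAt ℝ (fderiv ℝ F) x :=
    (hc.fderiv_right (m := ∞) (by simp)).differentiableAt (by simp)
  have key : ∀ k l : ι, pderiv k (pderiv l F) x
      = fderiv ℝ (fderiv ℝ F) x (Pi.single k 1) (Pi.single l 1) := fun k l => by
    unfold pderiv
    rw [fderiv_clm_apply hd (differentiableAt_const _)]
    simp
  rw [key, key]
  exact (hc.isSymmSndFDerivAt (by simpa using WithTop.coe_le_coe.2 (le_top : (2 : ℕ∞) ≤ ⊤))).eq _ _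

end Calculus

/-! ### Euler's relation and its derivatives -/

section Euler

variable {U : Set (Fin 3 → ℝ)} {f : (Fin 3 → ℝ) → ℝ} {d : ℝ} {x : Fin 3 → ℝ}

/-- Differentiate t ↦ f(tx) at t = 1. Since U need not be a cone, homogeneity is available only for
t near 1, which suffices. -/
theorem euler (hU : IsOpen U) (hf : ContDiffOn ℝ ∞ f U) (hhom : IsHomogeneousOn d f U)
    (hx : x ∈ U) : ∑ i, pderiv i f x * x i = d * f x := by
  rw [← fderiv_eq_sum_pderiv]
  have hfx := differentiableAt_of_contDiffOn hU hf hx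
  have h1 : HasDerivAt (fun t : ℝ => f (t • x)) (fderiv ℝ f x x) 1 := by
    have h2 : HasDerivAt (fun t : ℝ => t • x) x 1 := by
      simpa using (hasDerivAt_id (1 : ℝ)).smul_const x
    have h3 : HasFDerivAt f (fderiv ℝ f x) ((1 : ℝ) • x) := by
      rw [one_smul]; exact hfx.hasFDerivAt
    exact h3.comp_hasDerivAt 1 h2
  have h4 : HasDerivAt (fun t : ℝ => t ^ d * f x) (d * f x) 1 := by
    have := (Real.hasDerivAt_rpow_const (x := 1) (p := d) (Or.inl one_ne_zero)).mul_const (f x)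
    simpa using this
  have hev : (fun t : ℝ => f (t • x)) =ᶠ[nhds 1] fun t => t ^ d * f x := by
    have hc : ContinuousAt (fun t : ℝ => t • x) 1 := by fun_prop
    have hm : U ∈ nhds ((1 : ℝ) • x) := by rw [one_smul]; exact hU.mem_nhds hx
    filter_upwards [hc.preimage_mem_nhds hm, lt_mem_nhds (zero_lt_one' ℝ)] with t ht ht0
    exact hhom x hx t ht0 ht
  exact h1.unique (h4.congr_of_eventuallyEq hev)

/-- If `∑ ∂ᵢF xᵢ = m F` on an open set then `∂ⱼF` satisfies the same identity with `m - 1`. -/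
theorem euler_pderiv {F : (Fin 3 → ℝ) → ℝ} {m : ℝ} (hU : IsOpen U) (hF : ContDiffOn ℝ ∞ F U)
    (h : ∀ y ∈ U, ∑ i, pderiv i F y * y i = m * F y) (j : Fin 3) :
    ∀ y ∈ U, ∑ i, pderiv i (pderiv j F) y * y i = (m - 1) * pderiv j F y := fun y hy => by
  have hd : ∀ i, DifferentiableAt ℝ (pderiv i F) y := fun i =>
    differentiableAt_of_contDiffOn hU (contDiffOn_pderiv hU hF i) hy
  have ha : ∀ i : Fin 3, DifferentiableAt ℝ (fun z : Fin 3 → ℝ => z i) y := fun i => by fun_prop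
  have h1 := eqOn_pderiv hU (F := fun y => ∑ i, pderiv i F y * y i) (G := fun y => m * F y) h j hy
  rw [pderiv_const_mul (differentiableAt_of_contDiffOn hU hF hy),
    pderiv_sum _ (fun i => (hd i).fun_mul (ha i))] at h1
  have h2 : ∀ i : Fin 3, pderiv j (fun y => pderiv i F y * y i) y
      = pderiv i (pderiv j F) y * y i + if j = i then pderiv j F y else 0 := fun i => by
    rw [pderiv_mul (hd i) (ha i), pderiv_apply, pderiv_comm hU hF hy j i]
    split_ifs with hji <;> simp [hji]
  simp only [h2, Finset.sum_add_distrib, Finset.sum_ite_eq, Finset.mem_univ, if_true] at h1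
  linarith

end Euler

/-! ### The Aronhold invariant and its weight -/

section Aronhold

/-- A trilinear form, given by its coefficients, is symmetric. -/
def IsSymmTrilinear (T : Fin 3 → Fin 3 → Fin 3 → ℝ) : Prop :=
  (∀ i j k, T i j k = T j i k) ∧ ∀ i j k, T i j k = T i k j

/-- The substitution of the linear map with matrix `P` into a trilinear form. -/
def trilinearPull (T : Fin 3 → Fin 3 → Fin 3 → ℝ) (P : Matrix (Fin 3) (Fin 3) ℝ) :
    Fin 3 → Fin 3 → Fin 3 → ℝ :=
  fun a b c => ∑ i, ∑ j, ∑ k, T i j k * P i a * P j b * P k c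

/-- The Aronhold invariant of a ternary cubic, in terms of its polarization. -/
def aronhold (T : Fin 3 → Fin 3 → Fin 3 → ℝ) : ℝ :=
  -(T 0 0 0 * T 0 2 2 - T 0 0 2 ^ 2) * T 1 1 2 ^ 2
    + (T 0 0 0 * T 2 2 2 - T 0 0 2 * T 0 2 2) * T 0 1 1 * T 1 1 2
    - (T 0 0 2 * T 2 2 2 - T 0 2 2 ^ 2) * T 0 1 1 ^ 2
    - T 0 0 1 ^ 2 * T 2 2 2 * T 1 1 2
    + T 0 0 1 * T 0 1 2 * (3 * T 0 2 2 * T 1 1 2 + T 2 2 2 * T 0 1 1)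
    - (T 0 0 1 * T 1 2 2 + 2 * T 0 1 2 ^ 2) * (T 0 0 2 * T 1 1 2 + T 0 2 2 * T 0 1 1)
    + T 0 1 2 * T 1 2 2 * (T 0 0 0 * T 1 1 2 + 3 * T 0 0 2 * T 0 1 1)
    - T 1 2 2 ^ 2 * T 0 0 0 * T 0 1 1
    + T 1 1 1 * (T 0 0 1 * (T 0 0 2 * T 2 2 2 - T 0 2 2 ^ 2)
      - T 0 1 2 * (T 0 0 0 * T 2 2 2 - T 0 0 2 * T 0 2 2)
      + T 1 2 2 * (T 0 0 0 * T 0 2 2 - T 0 0 2 ^ 2))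
    + (T 0 0 1 * T 1 2 2 - T 0 1 2 ^ 2) ^ 2

variable {T : Fin 3 → Fin 3 → Fin 3 → ℝ} {P Q : Matrix (Fin 3) (Fin 3) ℝ}

theorem trilinearPull_mul (T : Fin 3 → Fin 3 → Fin 3 → ℝ) (P Q : Matrix (Fin 3) (Fin 3) ℝ) :
    trilinearPull T (P * Q) = trilinearPull (trilinearPull T P) Q := by
  funext a b c
  have h : ∀ l m n, trilinearPull T P l m n * Q l a * Q m b * Q n c
      = ∑ i, ∑ j, ∑ k, T i j k * (P i l * Q l a) * (P j m * Q m b) * (P k n * Q n c) := by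
    intro l m n
    simp only [trilinearPull, Finset.sum_mul]
    refine Finset.sum_congr rfl fun i _ => Finset.sum_congr rfl fun j _ =>
      Finset.sum_congr rfl fun k _ => ?_
    ring
  have h2 : ∀ i j k, T i j k * (P * Q) i a * (P * Q) j b * (P * Q) k c
      = ∑ l, ∑ m, ∑ n, T i j k * (P i l * Q l a) * (P j m * Q m b) * (P k n * Q n c) := by
    intro i j k
    simp only [Matrix.mul_apply, ← Finset.mul_sum, ← Finset.sum_mul]
  -- Flattening each triple sum to one sum over a product lets a single `Finset.sum_comm` exchange
  -- both triples.
  have h3 : ∀ g : Fin 3 → Fin 3 → Fin 3 → ℝ,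
      ∑ i, ∑ j, ∑ k, g i j k = ∑ p : Fin 3 × Fin 3 × Fin 3, g p.1 p.2.1 p.2.2 := fun g => by
    simp only [Fintype.sum_prod_type]
  calc _ = ∑ i, ∑ j, ∑ k, T i j k * (P * Q) i a * (P * Q) j b * (P * Q) k c := rfl
    _ = ∑ l, ∑ m, ∑ n, trilinearPull T P l m n * Q l a * Q m b * Q n c := by
      simp only [h, h2]
      simp only [h3]
      exact Finset.sum_comm
    _ = _ := rfl

theorem IsSymmTrilinear.pull (hT : IsSymmTrilinear T) (P : Matrix (Fin 3) (Fin 3) ℝ) :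
    IsSymmTrilinear (trilinearPull T P) := by
  constructor
  · intro a b c
    unfold trilinearPull
    rw [Finset.sum_comm]
    refine Finset.sum_congr rfl fun i _ => Finset.sum_congr rfl fun j _ =>
      Finset.sum_congr rfl fun k _ => ?_
    rw [hT.1]; ring
  · intro a b c
    unfold trilinearPull
    refine Finset.sum_congr rfl fun i _ => ?_
    rw [Finset.sum_comm]
    refine Finset.sum_congr rfl fun j _ => Finset.sum_congr rfl fun k _ => ?_
    rw [hT.2]; ring

theorem aronhold_pull_diagonal (D : Fin 3 → ℝ) :
    aronhold (trilinearPull T (Matrix.diagonal D)) =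
      (Matrix.diagonal D).det ^ 4 * aronhold T := by
  have h : ∀ a b c, trilinearPull T (Matrix.diagonal D) a b c = T a b c * D a * D b * D c := by
    intro a b c
    simp [trilinearPull, Matrix.diagonal_apply]
  simp only [aronhold, h, Matrix.det_diagonal, Fin.prod_univ_three]
  ring

theorem aronhold_pull_transvection (hT : IsSymmTrilinear T) {i j : Fin 3} (hij : i ≠ j) (c : ℝ) :
    aronhold (trilinearPull T (Matrix.transvection i j c)) = aronhold T := by
  -- The matrix is 1 + cE_ij, so expanding the three slots gives eight terms.
  have h : ∀ l m n, trilinearPull T (Matrix.transvection i j c) l m n =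
      T l m n + (if j = l then c * T i m n else 0) + (if j = m then c * T l i n else 0)
      + (if j = n then c * T l m i else 0)
      + (if j = l ∧ j = m then c ^ 2 * T i i n else 0)
      + (if j = l ∧ j = n then c ^ 2 * T i m i else 0)
      + (if j = m ∧ j = n then c ^ 2 * T l i i else 0)
      + (if j = l ∧ j = m ∧ j = n then c ^ 3 * T i i i else 0) := by
    intro l m n
    have hP : ∀ a b, Matrix.transvection i j c a b =
        (if a = b then 1 else 0) + (if i = a then (if j = b then c else 0) else 0) := by
      intro a b
      simp only [Matrix.transvection, Matrix.add_apply, Matrix.one_apply, Matrix.single_apply]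
      congr 1
      split_ifs <;> simp_all
    simp only [trilinearPull, hP, mul_add, add_mul, Finset.sum_add_distrib, mul_ite, mul_one,
      mul_zero, ite_mul, zero_mul, Finset.sum_ite_eq, Finset.sum_ite_eq', Finset.mem_univ, if_true,
      Finset.sum_ite_irrel, Finset.sum_const_zero]
    rcases eq_or_ne j l with rfl | hl <;> rcases eq_or_ne j m with rfl | hm <;>
      rcases eq_or_ne j n with rfl | hn <;> simp [*] <;> ring
  obtain ⟨h1, h2⟩ := hT
  have e1 : T 0 1 0 = T 0 0 1 := h2 _ _ _
  have e2 : T 0 2 0 = T 0 0 2 := h2 _ _ _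
  have e3 : T 1 0 0 = T 0 0 1 := by rw [h1, e1]
  have e4 : T 2 0 0 = T 0 0 2 := by rw [h1, e2]
  have e5 : T 1 0 1 = T 0 1 1 := h1 _ _ _
  have e6 : T 1 1 0 = T 0 1 1 := by rw [h2, e5]
  have e7 : T 1 2 1 = T 1 1 2 := h2 _ _ _
  have e8 : T 2 1 1 = T 1 1 2 := by rw [h1, e7]
  have e9 : T 2 0 2 = T 0 2 2 := h1 _ _ _
  have e10 : T 2 2 0 = T 0 2 2 := by rw [h2, e9]
  have e11 : T 2 1 2 = T 1 2 2 := h1 _ _ _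
  have e12 : T 2 2 1 = T 1 2 2 := by rw [h2, e11]
  have e13 : T 0 2 1 = T 0 1 2 := h2 _ _ _
  have e14 : T 1 0 2 = T 0 1 2 := h1 _ _ _
  have e15 : T 1 2 0 = T 0 1 2 := by rw [h2, e14]
  have e16 : T 2 0 1 = T 0 1 2 := by rw [h1, e13]
  clear h1 h2
  -- Six ordered pairs remain, each a polynomial identity in the independent coefficients of the
  -- cubic.
  fin_cases i <;> fin_cases j <;> first | exact absurd rfl hij | skip
  all_goals
    simp only [aronhold, h]
    simp [e1, e2, e3, e4, e5, e6, e7, e8, e9, e10, e11, e12, e13, e14, e15, e16]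
    ring

/-- The Aronhold invariant has weight four. -/
theorem aronhold_pull (hT : IsSymmTrilinear T) (hP : P.det ≠ 0) :
    aronhold (trilinearPull T P) = P.det ^ 4 * aronhold T := by
  -- The motive quantifies over T because in a product the right factor acts on the form already
  -- pulled back along the left one.
  refine Matrix.diagonal_transvection_induction_of_det_ne_zero
    (fun P => ∀ T, IsSymmTrilinear T → aronhold (trilinearPull T P) = P.det ^ 4 * aronhold T)
    P hP (fun D _ T _ => aronhold_pull_diagonal D) ?_ ?_ T hT
  · intro t T hT
    rw [Matrix.TransvectionStruct.toMatrix, aronhold_pull_transvection hT t.hij,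
      Matrix.det_transvection_of_ne _ _ t.hij]
    simp
  · intro A B _ _ hA hB T hT
    rw [trilinearPull_mul, hB _ (hT.pull A), hA _ hT, Matrix.det_mul]
    ring

theorem clebsch_eq_aronhold (f : (Fin 3 → ℝ) → ℝ) (x : Fin 3 → ℝ) :
    clebsch f x = aronhold (third f x) := rfl

end Aronhold

/-! ### Linear algebra of the 3-jet in a frame (u, v, x) -/

section Jet

open Matrix

/-- The covector `T(u, v, ·)`. -/
def contractTwo (T : Fin 3 → Fin 3 → Fin 3 → ℝ) (u v : Fin 3 → ℝ) : Fin 3 → ℝ :=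
  fun k => ∑ i, ∑ j, T i j k * u i * v j

/-- The bilinear form on covectors dual to the form with matrix `H`. -/
noncomputable def dualForm (H : Matrix (Fin 3) (Fin 3) ℝ) (ξ η : Fin 3 → ℝ) : ℝ := ξ ⬝ᵥ H⁻¹ *ᵥ η

/-- The Gram determinant of `u` and `v` for the form with matrix `H`. -/
def gram (H : Matrix (Fin 3) (Fin 3) ℝ) (u v : Fin 3 → ℝ) : ℝ :=
  (u ⬝ᵥ H *ᵥ u) * (v ⬝ᵥ H *ᵥ v) - (u ⬝ᵥ H *ᵥ v) ^ 2

/-- The relations between the derivatives at `x` of a function homogeneous of degree `d` with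
value one at `x`: the gradient `ν`, the Hessian `H` and the third derivatives `T`. -/
structure IsHomogeneousJet (d : ℝ) (x ν : Fin 3 → ℝ) (H : Matrix (Fin 3) (Fin 3) ℝ)
    (T : Fin 3 → Fin 3 → Fin 3 → ℝ) : Prop where
  symm_hessian : Hᵀ = H
  symm_third : IsSymmTrilinear T
  det_ne_zero : H.det ≠ 0
  euler_grad : ν ⬝ᵥ x = d
  euler_hessian : H *ᵥ x = (d - 1) • ν
  euler_third : ∀ i j, ∑ k, T i j k * x k = (d - 2) * H i j

/-- `u` and `v` span the tangent plane `ker ν` at `x`, to which `x` is transversal. -/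
structure IsTangentFrame (x ν u v : Fin 3 → ℝ) : Prop where
  left : ν ⬝ᵥ u = 0
  right : ν ⬝ᵥ v = 0
  det_ne_zero : (Matrix.of ![u, v, x]).det ≠ 0

variable {d : ℝ} {x ν u v : Fin 3 → ℝ} {H : Matrix (Fin 3) (Fin 3) ℝ}
  {T : Fin 3 → Fin 3 → Fin 3 → ℝ}

theorem dotProduct_mulVec_symm (hH : Hᵀ = H) (a b : Fin 3 → ℝ) :
    a ⬝ᵥ H *ᵥ b = b ⬝ᵥ H *ᵥ a := by
  rw [dotProduct_mulVec, ← mulVec_transpose, hH, dotProduct_comm]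

theorem contractTwo_dotProduct (T : Fin 3 → Fin 3 → Fin 3 → ℝ) (a b c : Fin 3 → ℝ) :
    contractTwo T a b ⬝ᵥ c = ∑ i, ∑ j, ∑ k, T i j k * a i * b j * c k := by
  simp only [contractTwo, dotProduct, Finset.sum_mul]
  rw [Finset.sum_comm]
  refine Finset.sum_congr rfl fun i _ => ?_
  rw [Finset.sum_comm]

theorem contractTwo_dotProduct_comm (hT : IsSymmTrilinear T) (a b c : Fin 3 → ℝ) :
    contractTwo T a b ⬝ᵥ c = contractTwo T b a ⬝ᵥ c := by
  congr 1
  funext k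
  unfold contractTwo
  rw [Finset.sum_comm]
  refine Finset.sum_congr rfl fun i _ => Finset.sum_congr rfl fun j _ => ?_
  rw [hT.1]; ring

theorem contractTwo_dotProduct_swap (hT : IsSymmTrilinear T) (a b c : Fin 3 → ℝ) :
    contractTwo T a b ⬝ᵥ c = contractTwo T a c ⬝ᵥ b := by
  simp only [contractTwo_dotProduct]
  refine Finset.sum_congr rfl fun i _ => ?_
  rw [Finset.sum_comm]
  refine Finset.sum_congr rfl fun i _ => Finset.sum_congr rfl fun j _ => ?_
  rw [hT.2]; ring

/-- The transpose turns the rows of P into the new basis, to match `Matrix.of ![u, v, x]`. -/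
theorem trilinearPull_eq_contractTwo (T : Fin 3 → Fin 3 → Fin 3 → ℝ)
    (P : Matrix (Fin 3) (Fin 3) ℝ) (a b c : Fin 3) :
    trilinearPull T Pᵀ a b c = contractTwo T (P a) (P b) ⬝ᵥ P c := by
  rw [contractTwo_dotProduct]; rfl

namespace IsHomogeneousJet

/-- This makes x orthogonal to ker ν with respect to H and, with `euler_grad`, gives x the square
d(d-1). -/
theorem dotProduct_mulVec_self (hJ : IsHomogeneousJet d x ν H T) (w : Fin 3 → ℝ) :
    w ⬝ᵥ H *ᵥ x = (d - 1) * (ν ⬝ᵥ w) := by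
  rw [hJ.euler_hessian, dotProduct_smul, dotProduct_comm, smul_eq_mul]

theorem contractTwo_dotProduct_self (hJ : IsHomogeneousJet d x ν H T) (a b : Fin 3 → ℝ) :
    contractTwo T a b ⬝ᵥ x = (d - 2) * (a ⬝ᵥ H *ᵥ b) := by
  rw [contractTwo_dotProduct]
  simp only [dotProduct, mulVec, Finset.mul_sum]
  refine Finset.sum_congr rfl fun i _ => Finset.sum_congr rfl fun j _ => ?_
  have : ∀ k, T i j k * a i * b j * x k = (T i j k * x k) * (a i * b j) := fun k => by ring
  simp only [this, ← Finset.sum_mul, hJ.euler_third]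
  ring

/-- The matrix of `H` in the basis `(u, v, x)`. -/
theorem frame_mul (hJ : IsHomogeneousJet d x ν H T) (hF : IsTangentFrame x ν u v) :
    Matrix.of ![u, v, x] * H * (Matrix.of ![u, v, x])ᵀ =
      !![u ⬝ᵥ H *ᵥ u, u ⬝ᵥ H *ᵥ v, 0; u ⬝ᵥ H *ᵥ v, v ⬝ᵥ H *ᵥ v, 0; 0, 0, d * (d - 1)] := by
  have h : ∀ a b, (Matrix.of ![u, v, x] * H * (Matrix.of ![u, v, x])ᵀ) a b
      = (![u, v, x] a) ⬝ᵥ H *ᵥ (![u, v, x] b) := fun a b => by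
    rw [dotProduct_mulVec]; rfl
  have h1 := dotProduct_mulVec_symm hJ.symm_hessian x u
  have h2 := dotProduct_mulVec_symm hJ.symm_hessian x v
  have h3 := dotProduct_mulVec_symm hJ.symm_hessian v u
  rw [hJ.dotProduct_mulVec_self, hF.left] at h1
  rw [hJ.dotProduct_mulVec_self, hF.right] at h2
  have h4 := hJ.dotProduct_mulVec_self x
  rw [hJ.euler_grad] at h4
  ext a b
  rw [h]
  fin_cases a <;> fin_cases b <;>
    simp [h1, h2, h3, h4, hJ.dotProduct_mulVec_self, hF.left, hF.right, mul_comm]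

/-- Take determinants in `frame_mul`. Nonvanishing of the Hessian determinant thereby passes to the
tangent plane. -/
theorem det_sq_mul_det (hJ : IsHomogeneousJet d x ν H T) (hF : IsTangentFrame x ν u v) :
    (Matrix.of ![u, v, x]).det ^ 2 * H.det = gram H u v * (d * (d - 1)) := by
  have h := congrArg Matrix.det (hJ.frame_mul hF)
  have hblock : ∀ A B C D : ℝ, (!![A, B, 0; B, C, 0; 0, 0, D]).det = (A * C - B ^ 2) * D :=
    fun A B C D => by simp [det_fin_three]; ring
  rw [det_mul, det_mul, det_transpose, hblock] at h
  unfold gram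
  linear_combination h

theorem gram_ne_zero (hJ : IsHomogeneousJet d x ν H T) (hF : IsTangentFrame x ν u v) :
    gram H u v ≠ 0 := fun h => by
  have := hJ.det_sq_mul_det hF
  rw [h, zero_mul] at this
  exact mul_ne_zero (pow_ne_zero 2 hF.det_ne_zero) hJ.det_ne_zero this

theorem dualForm_mulVec (hJ : IsHomogeneousJet d x ν H T) (w η : Fin 3 → ℝ) :
    dualForm H (H *ᵥ w) η = w ⬝ᵥ η := by
  have h1 : IsUnit H.det := hJ.det_ne_zero.isUnit
  rw [dualForm, dotProduct_comm, dotProduct_mulVec, ← mulVec_transpose, hJ.symm_hessian,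
    mulVec_mulVec, mul_nonsing_inv _ h1, one_mulVec, dotProduct_comm]

theorem dualForm_comm (hJ : IsHomogeneousJet d x ν H T) (ξ η : Fin 3 → ℝ) :
    dualForm H ξ η = dualForm H η ξ := by
  apply dotProduct_mulVec_symm
  rw [transpose_nonsing_inv, hJ.symm_hessian]

/-- The dual form in the basis `(u, v, x)`. -/
theorem dualForm_eq (hd : 2 < d) (hJ : IsHomogeneousJet d x ν H T)
    (hF : IsTangentFrame x ν u v) (ξ η : Fin 3 → ℝ) :
    dualForm H ξ η =
      ((v ⬝ᵥ H *ᵥ v) * ((ξ ⬝ᵥ u) * (η ⬝ᵥ u))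
        - (u ⬝ᵥ H *ᵥ v) * ((ξ ⬝ᵥ u) * (η ⬝ᵥ v) + (ξ ⬝ᵥ v) * (η ⬝ᵥ u))
        + (u ⬝ᵥ H *ᵥ u) * ((ξ ⬝ᵥ v) * (η ⬝ᵥ v))) / gram H u v
      + (ξ ⬝ᵥ x) * (η ⬝ᵥ x) / (d * (d - 1)) := by
  have hΔ := hJ.gram_ne_zero hF
  have hd0 : d ≠ 0 := by linarith
  have hd1 : d - 1 ≠ 0 := by linarith
  have hP := hJ.frame_mul hF
  set P := Matrix.of ![u, v, x] with hPdef
  set A := u ⬝ᵥ H *ᵥ u with hA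
  set B := u ⬝ᵥ H *ᵥ v with hB
  set C := v ⬝ᵥ H *ᵥ v with hC
  set Δ := gram H u v with hΔd
  have hΔe : Δ = A * C - B ^ 2 := rfl
  -- The inverse of the block diagonal matrix of H in the frame.
  let N : Matrix (Fin 3) (Fin 3) ℝ :=
    !![C / Δ, -B / Δ, 0; -B / Δ, A / Δ, 0; 0, 0, 1 / (d * (d - 1))]
  have hN : P * H * Pᵀ * N = 1 := by
    rw [hP]
    ext a b
    fin_cases a <;> fin_cases b <;> simp [N, Matrix.mul_apply, Fin.sum_univ_three] <;>
      field_simp <;> simp only [hΔe] <;> ring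
  have hPu : IsUnit P := (isUnit_iff_isUnit_det P).2 hF.det_ne_zero.isUnit
  have hinv : H⁻¹ = Pᵀ * N * P := by
    apply inv_eq_right_inv
    have h2 : P * (H * (Pᵀ * N)) = 1 := by simpa only [Matrix.mul_assoc] using hN
    have h3 : H * (Pᵀ * N) * P = 1 := mul_eq_one_comm.1 h2
    simpa only [Matrix.mul_assoc] using h3
  have hPx : ∀ ζ : Fin 3 → ℝ, P *ᵥ ζ = ![ζ ⬝ᵥ u, ζ ⬝ᵥ v, ζ ⬝ᵥ x] := fun ζ => by
    ext a
    fin_cases a <;> simp [hPdef, mulVec, dotProduct_comm]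
  have h4 : dualForm H ξ η = (P *ᵥ ξ) ⬝ᵥ N *ᵥ (P *ᵥ η) := by
    rw [dualForm, hinv, ← mulVec_mulVec, ← mulVec_mulVec, dotProduct_mulVec ξ, vecMul_transpose]
  rw [h4, hPx, hPx]
  simp [N, dotProduct, mulVec, Fin.sum_univ_three]
  field_simp
  ring

/-- The quantity that gives the curvature of the Hessian metric on `ker ν`. -/
theorem dualForm_sub_div_gram (hd : 2 < d) (hJ : IsHomogeneousJet d x ν H T)
    (hF : IsTangentFrame x ν u v) :
    (dualForm H (contractTwo T u u) (contractTwo T v v)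
      - dualForm H (contractTwo T u v) (contractTwo T u v)) / gram H u v =
      d * (d - 1) / (d - 2) ^ 2 * (aronhold T / H.det ^ 2) := by
  have hΔ := hJ.gram_ne_zero hF
  have hd0 : d ≠ 0 := by linarith
  have hd1 : d - 1 ≠ 0 := by linarith
  have hd2 : d - 2 ≠ 0 := by linarith
  have hdet := hJ.det_sq_mul_det hF
  -- Weight four, applied to the change of basis to (u, v, x).
  have hS := aronhold_pull (P := (Matrix.of ![u, v, x])ᵀ) hJ.symm_third
    (by rw [det_transpose]; exact hF.det_ne_zero)
  rw [det_transpose] at hS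
  have hT := hJ.symm_third
  have r0 : (Matrix.of ![u, v, x]) 0 = u := rfl
  have r1 : (Matrix.of ![u, v, x]) 1 = v := rfl
  have r2 : (Matrix.of ![u, v, x]) 2 = x := rfl
  have sx : ∀ a, contractTwo T a x ⬝ᵥ x = (d - 2) * ((d - 1) * (ν ⬝ᵥ a)) := fun a => by
    rw [hJ.contractTwo_dotProduct_self, hJ.dotProduct_mulVec_self]
  have s1 := contractTwo_dotProduct_swap hT u v u
  have s2 := contractTwo_dotProduct_swap hT v v u
  have s3 := contractTwo_dotProduct_comm hT v u v
  -- Coefficients with exactly one x become entries of H, those with exactly two vanish, and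
  -- T(x,x,x) is (d-2)(d-1)d.
  simp only [aronhold, trilinearPull_eq_contractTwo, r0, r1, r2, sx, hF.left, hF.right,
    hJ.euler_grad, hJ.contractTwo_dotProduct_self] at hS
  rw [hJ.dualForm_eq hd hF, hJ.dualForm_eq hd hF]
  simp only [hJ.contractTwo_dotProduct_self, s1, s2, s3]
  have hH : H.det = gram H u v * (d * (d - 1)) / (Matrix.of ![u, v, x]).det ^ 2 := by
    rw [← hdet]; field_simp [hF.det_ne_zero]
  have hp := hF.det_ne_zero
  rw [hH]
  change _ = d * (d - 1) / (d - 2) ^ 2 * (aronhold T / _)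
  have hΔe : gram H u v = (u ⬝ᵥ H *ᵥ u) * (v ⬝ᵥ H *ᵥ v) - (u ⬝ᵥ H *ᵥ v) ^ 2 := rfl
  have hS' : aronhold T * (Matrix.of ![u, v, x]).det ^ 4 = _ := (mul_comm _ _).trans hS.symm
  -- The square of the Hessian determinant contributes the fourth power of the frame determinant,
  -- exactly the weight of the invariant, so the latter cancels.
  rw [show ∀ a b c : ℝ, a / (b / c ^ 2) ^ 2 = a * c ^ 4 / b ^ 2 from fun a b c => by
    rw [div_pow, div_div_eq_mul_div, ← pow_mul], hS']
  clear hS hS' hH hdet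
  field_simp
  rw [hΔe]
  ring

/-- The algebraic core of the Gauss equation for the level surface. Here `w₀₀, w₀₁, w₁₁` are the
second derivatives of a parametrization with first derivatives `u` and `v`. -/
theorem gauss_algebra (hd : 2 < d) (hJ : IsHomogeneousJet d x ν H T)
    (hF : IsTangentFrame x ν u v) {w₀₀ w₀₁ w₁₁ : Fin 3 → ℝ}
    (h₀₀ : ν ⬝ᵥ w₀₀ = -(u ⬝ᵥ H *ᵥ u)) (h₀₁ : ν ⬝ᵥ w₀₁ = -(u ⬝ᵥ H *ᵥ v))
    (h₁₁ : ν ⬝ᵥ w₁₁ = -(v ⬝ᵥ H *ᵥ v)) :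
    w₀₀ ⬝ᵥ H *ᵥ w₁₁ - w₀₁ ⬝ᵥ H *ᵥ w₀₁
      + 1 / 2 * (contractTwo T v v ⬝ᵥ w₀₀ + contractTwo T u u ⬝ᵥ w₁₁
        - 2 * (contractTwo T u v ⬝ᵥ w₀₁))
      - ((v ⬝ᵥ H *ᵥ v) * ((w₀₀ ⬝ᵥ H *ᵥ u + 1 / 2 * (contractTwo T u u ⬝ᵥ u))
              * (w₁₁ ⬝ᵥ H *ᵥ u + 1 / 2 * (contractTwo T v v ⬝ᵥ u))
            - (w₀₁ ⬝ᵥ H *ᵥ u + 1 / 2 * (contractTwo T u v ⬝ᵥ u)) ^ 2)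
          - (u ⬝ᵥ H *ᵥ v) * ((w₀₀ ⬝ᵥ H *ᵥ u + 1 / 2 * (contractTwo T u u ⬝ᵥ u))
              * (w₁₁ ⬝ᵥ H *ᵥ v + 1 / 2 * (contractTwo T v v ⬝ᵥ v))
            + (w₀₀ ⬝ᵥ H *ᵥ v + 1 / 2 * (contractTwo T u u ⬝ᵥ v))
              * (w₁₁ ⬝ᵥ H *ᵥ u + 1 / 2 * (contractTwo T v v ⬝ᵥ u))
            - 2 * ((w₀₁ ⬝ᵥ H *ᵥ u + 1 / 2 * (contractTwo T u v ⬝ᵥ u))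
              * (w₀₁ ⬝ᵥ H *ᵥ v + 1 / 2 * (contractTwo T u v ⬝ᵥ v))))
          + (u ⬝ᵥ H *ᵥ u) * ((w₀₀ ⬝ᵥ H *ᵥ v + 1 / 2 * (contractTwo T u u ⬝ᵥ v))
              * (w₁₁ ⬝ᵥ H *ᵥ v + 1 / 2 * (contractTwo T v v ⬝ᵥ v))
            - (w₀₁ ⬝ᵥ H *ᵥ v + 1 / 2 * (contractTwo T u v ⬝ᵥ v)) ^ 2)) / gram H u v
      = -(1 / 4) * (dualForm H (contractTwo T u u) (contractTwo T v v)
          - dualForm H (contractTwo T u v) (contractTwo T u v))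
        + d / (4 * (d - 1)) * gram H u v := by
  have hd0 : d ≠ 0 := by linarith
  have hd1 : d - 1 ≠ 0 := by linarith
  have hΔ := hJ.gram_ne_zero hF
  -- Completing the square: the terms in w and T on the left of the goal are the dual form of the
  -- covectors Hw + T/2, up to the part quadratic in T.
  have hexp : ∀ a b ξ η, dualForm H (H *ᵥ a + (1 / 2 : ℝ) • ξ) (H *ᵥ b + (1 / 2 : ℝ) • η)
      = a ⬝ᵥ H *ᵥ b + 1 / 2 * (η ⬝ᵥ a + ξ ⬝ᵥ b) + 1 / 4 * dualForm H ξ η := by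
    intro a b ξ η
    have e1 : ∀ p q r : Fin 3 → ℝ, dualForm H (p + q) r = dualForm H p r + dualForm H q r :=
      fun p q r => add_dotProduct _ _ _
    have e2 : ∀ (t : ℝ) (q r : Fin 3 → ℝ), dualForm H (t • q) r = t * dualForm H q r :=
      fun t q r => smul_dotProduct _ _ _
    rw [e1, hJ.dualForm_mulVec, dotProduct_add, dotProduct_smul, e2, hJ.dualForm_comm ξ, e1,
      hJ.dualForm_mulVec, e2, hJ.dualForm_comm η, dotProduct_comm b, dotProduct_comm a η]
    simp only [smul_eq_mul]
    ring
  have hval : ∀ a ξ c, (H *ᵥ a + (1 / 2 : ℝ) • ξ) ⬝ᵥ c = a ⬝ᵥ H *ᵥ c + 1 / 2 * (ξ ⬝ᵥ c) := by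
    intro a ξ c
    rw [add_dotProduct, smul_dotProduct, dotProduct_comm, dotProduct_mulVec_symm hJ.symm_hessian,
      smul_eq_mul]
  have k1 := hexp w₀₀ w₁₁ (contractTwo T u u) (contractTwo T v v)
  have k2 := hexp w₀₁ w₀₁ (contractTwo T u v) (contractTwo T u v)
  -- The same dual forms are split into a tangential part, which is the Christoffel term of the
  -- goal, and a part along x. On x the covectors take the values -(d-1)h + (d-2)h/2 = -(d/2)h,
  -- where h is the matching entry of H.
  rw [hJ.dualForm_eq hd hF] at k1 k2
  simp only [hval, hJ.dotProduct_mulVec_self, hJ.contractTwo_dotProduct_self, h₀₀, h₀₁, h₁₁]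
    at k1 k2
  have hg : gram H u v / (d * (d - 1)) * (d ^ 2 / 4) = d / (4 * (d - 1)) * gram H u v := by
    field_simp
  rw [← hg]
  have hΔe : gram H u v = (u ⬝ᵥ H *ᵥ u) * (v ⬝ᵥ H *ᵥ v) - (u ⬝ᵥ H *ᵥ v) ^ 2 := rfl
  nth_rw 2 [hΔe]
  linear_combination k2 - k1

end IsHomogeneousJet

end Jet

/-! ### The curvature tensor of a general metric -/

section RiemannTensor

variable {ι : Type*} [Fintype ι] [DecidableEq ι] {V : Set (ι → ℝ)}
  {g : (ι → ℝ) → Matrix ι ι ℝ} {s : ι → ℝ}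

/-- The second derivatives of g_{lk} cancel because partial derivatives commute. This form suits the
induced metric, whose Christoffel symbols are explicit. -/
theorem riemann_eq_pderiv_christoffel (hV : IsOpen V)
    (hg : ∀ i j, ContDiffOn ℝ ∞ (fun y => g y i j) V) (hs : s ∈ V) (i j k l : ι) :
    riemann g s i j k l =
      pderiv j (fun y => christoffel g y i l k) s - pderiv i (fun y => christoffel g y j l k) s
      - ∑ p, ∑ q, (g s)⁻¹ p q *
        (christoffel g s j p l * christoffel g s i q k
          - christoffel g s i p l * christoffel g s j q k) := by
  have hd : ∀ m a b, DifferentiableAt ℝ (pderiv m (fun y => g y a b)) s := fun m a b =>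
    differentiableAt_of_contDiffOn hV (contDiffOn_pderiv hV (hg a b) m) hs
  have key : ∀ m a b c, pderiv m (fun y => christoffel g y a b c) s =
      1 / 2 * (pderiv m (pderiv c (fun y => g y a b)) s + pderiv m (pderiv a (fun y => g y b c)) s
        - pderiv m (pderiv b (fun y => g y a c)) s) := fun m a b c => by
    unfold christoffel
    rw [pderiv_const_mul (((hd _ _ _).fun_add (hd _ _ _)).fun_sub (hd _ _ _)),
      pderiv_sub ((hd _ _ _).fun_add (hd _ _ _)) (hd _ _ _), pderiv_add (hd _ _ _) (hd _ _ _)]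
  rw [key, key, riemann, pderiv_comm hV (hg i k) hs l j, pderiv_comm hV (hg j l) hs k i,
    pderiv_comm hV (hg i l) hs k j, pderiv_comm hV (hg j k) hs l i,
    pderiv_comm hV (hg l k) hs i j]
  ring

theorem riemann_swap_left (i j k l : ι) : riemann g s j i k l = -riemann g s i j k l := by
  have : ∑ p, ∑ q, (g s)⁻¹ p q *
        (christoffel g s i p l * christoffel g s j q k
          - christoffel g s j p l * christoffel g s i q k) =
      -∑ p, ∑ q, (g s)⁻¹ p q *
        (christoffel g s j p l * christoffel g s i q k
          - christoffel g s i p l * christoffel g s j q k) := by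
    simp only [← Finset.sum_neg_distrib]
    refine Finset.sum_congr rfl fun p _ => Finset.sum_congr rfl fun q _ => ?_
    ring
  rw [riemann, riemann, this]
  ring

theorem riemann_swap_right (hg : (g s).transpose = g s) (i j k l : ι) :
    riemann g s i j l k = -riemann g s i j k l := by
  have hinv : ∀ p q, (g s)⁻¹ p q = (g s)⁻¹ q p := fun p q => by
    conv_lhs => rw [← hg, ← Matrix.transpose_nonsing_inv]
    rfl
  have : ∑ p, ∑ q, (g s)⁻¹ p q *
        (christoffel g s j p k * christoffel g s i q l
          - christoffel g s i p k * christoffel g s j q l) =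
      -∑ p, ∑ q, (g s)⁻¹ p q *
        (christoffel g s j p l * christoffel g s i q k
          - christoffel g s i p l * christoffel g s j q k) := by
    rw [Finset.sum_comm]
    simp only [← Finset.sum_neg_distrib]
    refine Finset.sum_congr rfl fun p _ => Finset.sum_congr rfl fun q _ => ?_
    rw [hinv q p]
    ring
  rw [riemann, riemann, this]
  ring

end RiemannTensor

/-! ### Ambient curvature of the Hessian metric -/

section HessianMetric

open Matrix

variable {U : Set (Fin 3 → ℝ)} {f : (Fin 3 → ℝ) → ℝ} {d : ℝ} {x : Fin 3 → ℝ}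

theorem isSymmTrilinear_third (hU : IsOpen U) (hf : ContDiffOn ℝ ∞ f U) (hx : x ∈ U) :
    IsSymmTrilinear (third f x) :=
  ⟨fun i j k => pderiv_comm hU (contDiffOn_pderiv hU hf k) hx i j,
    fun i j k => eqOn_pderiv hU (fun _ hy => pderiv_comm hU hf hy j k) i hx⟩

theorem hessian_transpose (hU : IsOpen U) (hf : ContDiffOn ℝ ∞ f U) (hx : x ∈ U) :
    (hessian f x)ᵀ = hessian f x := by
  ext i j
  exact pderiv_comm hU hf hx j i

theorem isHomogeneousJet (hU : IsOpen U) (hf : ContDiffOn ℝ ∞ f U)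
    (hhom : IsHomogeneousOn d f U) (hH : hessianDet f x ≠ 0) (hx : x ∈ U) (hx1 : f x = 1) :
    IsHomogeneousJet d x (fun i => pderiv i f x) (hessian f x) (third f x) where
  symm_hessian := hessian_transpose hU hf hx
  symm_third := isSymmTrilinear_third hU hf hx
  det_ne_zero := hH
  euler_grad := by
    have := euler hU hf hhom hx
    rw [hx1, mul_one] at this
    exact this
  euler_hessian := by
    ext j
    have h := euler_pderiv hU hf (fun y hy => euler hU hf hhom hy) j x hx
    simp only [mulVec, dotProduct, hessian, of_apply, Pi.smul_apply, smul_eq_mul, ← h]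
    exact Finset.sum_congr rfl fun i _ => by rw [pderiv_comm hU hf hx]
  euler_third := fun i j => by
    have h := euler_pderiv hU (contDiffOn_pderiv hU hf j)
      (euler_pderiv hU hf (fun y hy => euler hU hf hhom hy) j) i x hx
    obtain ⟨s1, s2⟩ := isSymmTrilinear_third hU hf hx
    calc _ = ∑ k, third f x k i j * x k :=
          Finset.sum_congr rfl fun k _ => by rw [s2, s1]
      _ = (d - 1 - 1) * hessian f x i j := h
      _ = _ := by ring

theorem contDiffOn_hessian (hU : IsOpen U) (hf : ContDiffOn ℝ ∞ f U) (i j : Fin 3) :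
    ContDiffOn ℝ ∞ (fun y => hessian f y i j) U :=
  contDiffOn_pderiv hU (contDiffOn_pderiv hU hf j) i

theorem contDiffOn_third (hU : IsOpen U) (hf : ContDiffOn ℝ ∞ f U) (i j k : Fin 3) :
    ContDiffOn ℝ ∞ (fun y => third f y i j k) U :=
  contDiffOn_pderiv hU (contDiffOn_pderiv hU (contDiffOn_pderiv hU hf k) j) i

theorem pderiv_hessianMetric (hU : IsOpen U) (hf : ContDiffOn ℝ ∞ f U) (hx : x ∈ U)
    (i j k : Fin 3) :
    pderiv k (fun y => hessianMetric d f y i j) x = -1 / (d * (d - 1)) * third f x k i j :=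
  pderiv_const_mul (differentiableAt_of_contDiffOn hU (contDiffOn_hessian hU hf i j) hx) _ _

/-- Total symmetry of the third derivatives makes two of the three terms cancel. -/
theorem christoffel_hessianMetric (hU : IsOpen U) (hf : ContDiffOn ℝ ∞ f U) (hx : x ∈ U)
    (i j k : Fin 3) :
    christoffel (hessianMetric d f) x i j k = -1 / (d * (d - 1)) / 2 * third f x i j k := by
  obtain ⟨s1, s2⟩ := isSymmTrilinear_third hU hf hx
  rw [christoffel, pderiv_hessianMetric hU hf hx, pderiv_hessianMetric hU hf hx,
    pderiv_hessianMetric hU hf hx, s1 j i k, s1 k i j, s2 i k j]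
  ring

/-- The fourth derivatives of f cancel in pairs, and the Christoffel term scales as c⁻¹(c/2)² = c/4.
-/
theorem riemann_hessianMetric (hU : IsOpen U) (hf : ContDiffOn ℝ ∞ f U) (hx : x ∈ U)
    (hH : hessianDet f x ≠ 0) (hd : 2 < d) (i j k l : Fin 3) :
    riemann (hessianMetric d f) x i j k l = -(-1 / (d * (d - 1)) / 4) *
      ∑ p, ∑ q, (hessian f x)⁻¹ p q *
        (third f x j l p * third f x i k q - third f x i l p * third f x j k q) := by
  obtain ⟨s1, s2⟩ := isSymmTrilinear_third hU hf hx
  have hd0 : d ≠ 0 := by linarith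
  have hd1 : d - 1 ≠ 0 := by linarith
  set c := -1 / (d * (d - 1)) with hc
  have hc0 : c ≠ 0 := by rw [hc]; positivity
  have h2 : ∀ m n a b, pderiv m (pderiv n (fun y => hessianMetric d f y a b)) x =
      c * pderiv m (fun y => third f y n a b) x := fun m n a b => by
    rw [eqOn_pderiv hU (fun y hy => pderiv_hessianMetric (d := d) hU hf hy a b n) m hx]
    exact pderiv_const_mul
      (differentiableAt_of_contDiffOn hU (contDiffOn_third hU hf n a b) hx) _ _
  have h3 : ∀ m n a b, pderiv m (fun y => third f y n a b) x =
      pderiv m (fun y => third f y a n b) x := fun m n a b =>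
    eqOn_pderiv hU (fun y hy => (isSymmTrilinear_third hU hf hy).1 n a b) m hx
  have hinv : (hessianMetric d f x)⁻¹ = c⁻¹ • (hessian f x)⁻¹ := by
    apply inv_eq_right_inv
    change (c • hessian f x) * _ = 1
    rw [smul_mul_smul_comm, mul_inv_cancel₀ hc0, mul_nonsing_inv _ (Ne.isUnit hH), one_smul]
  rw [riemann, h2, h2, h2, h2, h3 l j i k, h3 k j i l, hinv]
  simp only [christoffel_hessianMetric hU hf hx, ← hc, Finset.mul_sum, Matrix.smul_apply, smul_eq_mul]
  rw [show ∀ a b e : ℝ, -(1 / 2) * (a + b - b - a) - e = -e by intros; ring]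
  simp only [← Finset.sum_neg_distrib]
  refine Finset.sum_congr rfl fun p _ => Finset.sum_congr rfl fun q _ => ?_
  rw [s2 j l p, s2 i k q, s2 i l p, s2 j k q]
  field_simp
  ring

/-- The index pairs (j,l) and (i,k) sit in different factors, so contraction with four vectors
factors for each p, q. -/
theorem sum_four_mul_sum_two (M : Matrix (Fin 3) (Fin 3) ℝ) (X Y : Fin 3 → Fin 3 → Fin 3 → ℝ)
    (a b a' b' : Fin 3 → ℝ) :
    ∑ i, ∑ j, ∑ k, ∑ l, (∑ p, ∑ q, M p q * (X j l p * Y i k q)) * a i * b j * a' k * b' l =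
      ∑ p, ∑ q, M p q * ((∑ j, ∑ l, X j l p * b j * b' l) * (∑ i, ∑ k, Y i k q * a i * a' k)) := by
  have h4 : ∀ g : Fin 3 → Fin 3 → Fin 3 → Fin 3 → ℝ, ∑ i, ∑ j, ∑ k, ∑ l, g i j k l =
      ∑ t : Fin 3 × Fin 3 × Fin 3 × Fin 3, g t.1 t.2.1 t.2.2.1 t.2.2.2 := fun g => by
    simp only [Fintype.sum_prod_type]
  have hmul : ∀ F E : Fin 3 → Fin 3 → ℝ, (∑ j, ∑ l, F j l) * (∑ i, ∑ k, E i k) =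
      ∑ i, ∑ j, ∑ k, ∑ l, F j l * E i k := fun F E => by
    rw [mul_comm, Finset.sum_mul]
    refine Finset.sum_congr rfl fun i _ => ?_
    rw [Finset.mul_sum]
    refine Finset.sum_congr rfl fun j _ => ?_
    rw [Finset.sum_mul_sum]
    exact Finset.sum_congr rfl fun k _ => Finset.sum_congr rfl fun l _ => mul_comm _ _
  refine (h4 _).trans (Eq.symm ?_)
  simp only [hmul]
  simp only [Finset.mul_sum]
  refine (Finset.sum_congr rfl fun p _ => Finset.sum_congr rfl fun q _ => h4 _).trans ?_
  rw [Finset.sum_comm_cycle]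
  refine Finset.sum_congr rfl fun t _ => ?_
  simp only [Finset.sum_mul]
  refine Finset.sum_congr rfl fun p _ => Finset.sum_congr rfl fun q _ => ?_
  ring

theorem sum_riemann_hessianMetric (hU : IsOpen U) (hf : ContDiffOn ℝ ∞ f U) (hx : x ∈ U)
    (hH : hessianDet f x ≠ 0) (hd : 2 < d) (u v : Fin 3 → ℝ) :
    ∑ i, ∑ j, ∑ k, ∑ l, riemann (hessianMetric d f) x i j k l * u i * v j * u k * v l =
      -(-1 / (d * (d - 1)) / 4) *
        (dualForm (hessian f x) (contractTwo (third f x) u u) (contractTwo (third f x) v v)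
        - dualForm (hessian f x) (contractTwo (third f x) u v) (contractTwo (third f x) u v)) := by
  have hsymm := isSymmTrilinear_third hU hf hx
  have hdual : ∀ ξ η : Fin 3 → ℝ, dualForm (hessian f x) ξ η =
      ∑ p, ∑ q, (hessian f x)⁻¹ p q * (ξ p * η q) := fun ξ η => by
    simp only [dualForm, dotProduct, mulVec, Finset.mul_sum]
    exact Finset.sum_congr rfl fun p _ => Finset.sum_congr rfl fun q _ => by ring
  have hvu : ∀ q, ∑ j, ∑ k, third f x j k q * v j * u k = contractTwo (third f x) u v q :=
    fun q => by
      rw [Finset.sum_comm]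
      refine Finset.sum_congr rfl fun i _ => Finset.sum_congr rfl fun j _ => ?_
      rw [hsymm.1]; ring
  have e1 := (sum_four_mul_sum_two (hessian f x)⁻¹ (third f x) (third f x) u v u v).trans
    (hdual (contractTwo (third f x) v v) (contractTwo (third f x) u u)).symm
  -- The second product has i and j exchanged: the first two vectors are swapped here and the outer
  -- sums next.
  have e2 := sum_four_mul_sum_two (hessian f x)⁻¹ (third f x) (third f x) v u u v
  rw [Finset.sum_comm] at e2
  simp only [hvu] at e2
  replace e2 := e2.trans
    (hdual (contractTwo (third f x) u v) (contractTwo (third f x) u v)).symm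
  have e3 : dualForm (hessian f x) (contractTwo (third f x) v v) (contractTwo (third f x) u u) =
      dualForm (hessian f x) (contractTwo (third f x) u u) (contractTwo (third f x) v v) := by
    apply dotProduct_mulVec_symm
    rw [transpose_nonsing_inv, hessian_transpose hU hf hx]
  rw [← e3, ← e1, ← e2]
  simp only [riemann_hessianMetric hU hf hx hH hd, ← Finset.sum_sub_distrib, Finset.mul_sum,
    Finset.sum_mul]
  refine Finset.sum_congr rfl fun i _ => Finset.sum_congr rfl fun j _ =>
    Finset.sum_congr rfl fun k _ => Finset.sum_congr rfl fun l _ =>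
    Finset.sum_congr rfl fun p _ => Finset.sum_congr rfl fun q _ => ?_
  ring

theorem metricInner_hessianMetric (u v : Fin 3 → ℝ) :
    metricInner (hessianMetric d f) x u v =
      -1 / (d * (d - 1)) * (u ⬝ᵥ hessian f x *ᵥ v) := by
  simp only [metricInner, hessianMetric, Matrix.smul_apply, smul_eq_mul, dotProduct, mulVec,
    Finset.mul_sum]
  exact Finset.sum_congr rfl fun i _ => Finset.sum_congr rfl fun j _ => by ring

/-- The quotient is -(c/4)Q/(c²·gram), and -1/(4c) = d(d-1)/4. -/
theorem sectionalQuotient_hessianMetric (hU : IsOpen U) (hf : ContDiffOn ℝ ∞ f U)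
    (hhom : IsHomogeneousOn d f U) (hH : hessianDet f x ≠ 0) (hd : 2 < d) (hx : x ∈ U)
    (hx1 : f x = 1) {u v : Fin 3 → ℝ} (hF : IsTangentFrame x (fun i => pderiv i f x) u v) :
    gramDet (hessianMetric d f) x u v ≠ 0 ∧
      sectionalQuotient (hessianMetric d f) x u v =
        d ^ 2 * (d - 1) ^ 2 / (4 * (d - 2) ^ 2) * (clebsch f x / hessianDet f x ^ 2) := by
  have hJ := isHomogeneousJet hU hf hhom hH hx hx1
  have hΔ := hJ.gram_ne_zero hF
  have hd0 : d ≠ 0 := by linarith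
  have hd1 : d - 1 ≠ 0 := by linarith
  have hd2 : d - 2 ≠ 0 := by linarith
  have hgram : gramDet (hessianMetric d f) x u v =
      (-1 / (d * (d - 1))) ^ 2 * gram (hessian f x) u v := by
    simp only [gramDet, metricInner_hessianMetric, gram]
    ring
  have hc : -1 / (d * (d - 1)) ≠ 0 := div_ne_zero (by norm_num) (mul_ne_zero hd0 hd1)
  refine ⟨by rw [hgram]; exact mul_ne_zero (pow_ne_zero 2 hc) hΔ, ?_⟩
  have hQ := hJ.dualForm_sub_div_gram hd hF
  rw [sectionalQuotient, sum_riemann_hessianMetric hU hf hx hH hd, hgram]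
  rw [div_eq_iff hΔ] at hQ
  rw [hQ, clebsch_eq_aronhold, hessianDet]
  have := hJ.det_ne_zero
  field_simp

end HessianMetric

/-! ### Differentiating forms in the derivatives of f along a map -/

section VectorCalculus

open Matrix

variable {U : Set (Fin 3 → ℝ)} {f : (Fin 3 → ℝ) → ℝ} {d : ℝ} {V : Set (Fin 2 → ℝ)}
  {φ X Y Z : (Fin 2 → ℝ) → (Fin 3 → ℝ)} {s : Fin 2 → ℝ}

/-- The partial derivative of a vector valued function, taken coordinatewise. -/
noncomputable def pderivVec (a : Fin 2) (X : (Fin 2 → ℝ) → (Fin 3 → ℝ)) :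
    (Fin 2 → ℝ) → (Fin 3 → ℝ) :=
  fun s i => pderiv a (fun t => X t i) s

theorem contDiffOn_pderivVec (hV : IsOpen V) (hX : ContDiffOn ℝ ∞ X V) (a : Fin 2) :
    ContDiffOn ℝ ∞ (pderivVec a X) V :=
  contDiffOn_pi.2 fun i => contDiffOn_pderiv hV (contDiffOn_pi.1 hX i) a

theorem pderivVec_comm (hV : IsOpen V) (hX : ContDiffOn ℝ ∞ X V) (hs : s ∈ V) (a b : Fin 2) :
    pderivVec a (pderivVec b X) s = pderivVec b (pderivVec a X) s :=
  funext fun i => pderiv_comm hV (contDiffOn_pi.1 hX i) hs a b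

theorem pderivVec_eq_fderiv (hφ : DifferentiableAt ℝ φ s) (a : Fin 2) :
    pderivVec a φ s = fderiv ℝ φ s (Pi.single a 1) := by
  funext i
  unfold pderivVec pderiv
  rw [fderiv_apply hφ]
  rfl

theorem differentiableAt_coord (hV : IsOpen V) (hX : ContDiffOn ℝ ∞ X V) (hs : s ∈ V) (i : Fin 3) :
    DifferentiableAt ℝ (fun t => X t i) s :=
  differentiableAt_of_contDiffOn hV (contDiffOn_pi.1 hX i) hs

theorem pderiv_comp_eq_dotProduct {F : (Fin 3 → ℝ) → ℝ} (hF : DifferentiableAt ℝ F (φ s))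
    (hφ : DifferentiableAt ℝ φ s) (a : Fin 2) :
    pderiv a (fun t => F (φ t)) s = (fun i => pderiv i F (φ s)) ⬝ᵥ pderivVec a φ s :=
  pderiv_comp hF hφ a

theorem pderiv_dotProduct (hV : IsOpen V) (hX : ContDiffOn ℝ ∞ X V) (hY : ContDiffOn ℝ ∞ Y V)
    (hs : s ∈ V) (a : Fin 2) :
    pderiv a (fun t => X t ⬝ᵥ Y t) s = pderivVec a X s ⬝ᵥ Y s + X s ⬝ᵥ pderivVec a Y s := by
  have h1 := differentiableAt_coord hV hX hs
  have h2 := differentiableAt_coord hV hY hs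
  simp only [dotProduct]
  rw [pderiv_sum _ (fun i => (h1 i).fun_mul (h2 i)), ← Finset.sum_add_distrib]
  exact Finset.sum_congr rfl fun i _ => pderiv_mul (h1 i) (h2 i) a

theorem pderiv_hessian_form (hU : IsOpen U) (hf : ContDiffOn ℝ ∞ f U) (hV : IsOpen V)
    (hφ : ContDiffOn ℝ ∞ φ V) (hφU : Set.MapsTo φ V U) (hX : ContDiffOn ℝ ∞ X V)
    (hY : ContDiffOn ℝ ∞ Y V) (hs : s ∈ V) (a : Fin 2) :
    pderiv a (fun t => X t ⬝ᵥ hessian f (φ t) *ᵥ Y t) s =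
      contractTwo (third f (φ s)) (pderivVec a φ s) (X s) ⬝ᵥ Y s
      + pderivVec a X s ⬝ᵥ hessian f (φ s) *ᵥ Y s
      + X s ⬝ᵥ hessian f (φ s) *ᵥ pderivVec a Y s := by
  have h1 := differentiableAt_coord hV hX hs
  have h2 := differentiableAt_coord hV hY hs
  have hφs : DifferentiableAt ℝ φ s :=
    (hφ.contDiffAt (hV.mem_nhds hs)).differentiableAt (by simp)
  have h3 : ∀ i j, DifferentiableAt ℝ (fun y => hessian f y i j) (φ s) := fun i j =>
    differentiableAt_of_contDiffOn hU (contDiffOn_hessian hU hf i j) (hφU hs)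
  have h4 : ∀ i j, DifferentiableAt ℝ (fun t => hessian f (φ t) i j) s := fun i j =>
    (h3 i j).fun_comp' s hφs
  have h5 : ∀ i j, DifferentiableAt ℝ (fun t => X t i * (hessian f (φ t) i j * Y t j)) s :=
    fun i j => (h1 i).fun_mul ((h4 i j).fun_mul (h2 j))
  simp only [contractTwo_dotProduct]
  simp only [dotProduct, mulVec, Finset.mul_sum]
  rw [pderiv_sum _ (fun i => DifferentiableAt.fun_sum fun j _ => h5 i j)]
  have h6 : ∀ i, pderiv a (fun t => ∑ j, X t i * (hessian f (φ t) i j * Y t j)) s =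
      ∑ j, ((∑ m, third f (φ s) m i j * pderivVec a φ s m) * (X s i * Y s j)
      + pderivVec a X s i * (hessian f (φ s) i j * Y s j)
      + X s i * (hessian f (φ s) i j * pderivVec a Y s j)) := fun i => by
    rw [pderiv_sum _ (fun j => h5 i j)]
    refine Finset.sum_congr rfl fun j _ => ?_
    rw [pderiv_mul (h1 i) ((h4 i j).fun_mul (h2 j)), pderiv_mul (h4 i j) (h2 j),
      pderiv_comp (h3 i j) hφs]
    change pderivVec a X s i * _ + X s i * ((∑ m, third f (φ s) m i j * pderivVec a φ s m) * _
      + _ * pderivVec a Y s j) = _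
    ring
  have h7 : ∀ g : Fin 3 → Fin 3 → Fin 3 → ℝ,
      ∑ m, ∑ i, ∑ j, g m i j = ∑ i, ∑ j, ∑ m, g m i j := fun g => by
    rw [Finset.sum_comm]
    exact Finset.sum_congr rfl fun i _ => Finset.sum_comm
  rw [h7]
  simp only [h6, ← Finset.sum_add_distrib]
  refine Finset.sum_congr rfl fun i _ => Finset.sum_congr rfl fun j _ => ?_
  simp only [← Finset.sum_mul]
  ring

/-- The fourth derivatives of f stay as a raw sum, since they will cancel by symmetry in
`riemann_inducedMetric`. -/
theorem pderiv_third_form (hU : IsOpen U) (hf : ContDiffOn ℝ ∞ f U) (hV : IsOpen V)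
    (hφ : ContDiffOn ℝ ∞ φ V) (hφU : Set.MapsTo φ V U) (hX : ContDiffOn ℝ ∞ X V)
    (hY : ContDiffOn ℝ ∞ Y V) (hZ : ContDiffOn ℝ ∞ Z V) (hs : s ∈ V) (a : Fin 2) :
    pderiv a (fun t => contractTwo (third f (φ t)) (X t) (Y t) ⬝ᵥ Z t) s =
      ∑ m, ∑ i, ∑ j, ∑ k, pderiv m (fun y => third f y i j k) (φ s) *
        pderivVec a φ s m * X s i * Y s j * Z s k
      + contractTwo (third f (φ s)) (pderivVec a X s) (Y s) ⬝ᵥ Z s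
      + contractTwo (third f (φ s)) (X s) (pderivVec a Y s) ⬝ᵥ Z s
      + contractTwo (third f (φ s)) (X s) (Y s) ⬝ᵥ pderivVec a Z s := by
  have h1 := differentiableAt_coord hV hX hs
  have h2 := differentiableAt_coord hV hY hs
  have h2' := differentiableAt_coord hV hZ hs
  have hφs : DifferentiableAt ℝ φ s :=
    (hφ.contDiffAt (hV.mem_nhds hs)).differentiableAt (by simp)
  have h3 : ∀ i j k, DifferentiableAt ℝ (fun y => third f y i j k) (φ s) := fun i j k =>
    differentiableAt_of_contDiffOn hU (contDiffOn_third hU hf i j k) (hφU hs)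
  have h4 : ∀ i j k, DifferentiableAt ℝ (fun t => third f (φ t) i j k) s := fun i j k =>
    (h3 i j k).fun_comp' s hφs
  have h5 : ∀ i j k, DifferentiableAt ℝ
      (fun t => third f (φ t) i j k * X t i * Y t j * Z t k) s :=
    fun i j k => (((h4 i j k).fun_mul (h1 i)).fun_mul (h2 j)).fun_mul (h2' k)
  simp only [contractTwo_dotProduct]
  have h7 : ∀ g : Fin 3 → Fin 3 → Fin 3 → Fin 3 → ℝ,
      ∑ m, ∑ i, ∑ j, ∑ k, g m i j k = ∑ i, ∑ j, ∑ k, ∑ m, g m i j k := fun g => by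
    rw [Finset.sum_comm]
    refine Finset.sum_congr rfl fun i _ => ?_
    rw [Finset.sum_comm]
    exact Finset.sum_congr rfl fun j _ => Finset.sum_comm
  rw [pderiv_sum _ (fun i => DifferentiableAt.fun_sum fun j _ =>
    DifferentiableAt.fun_sum fun k _ => h5 i j k), h7]
  simp only [← Finset.sum_add_distrib]
  refine Finset.sum_congr rfl fun i _ => ?_
  rw [pderiv_sum _ (fun j => DifferentiableAt.fun_sum fun k _ => h5 i j k)]
  refine Finset.sum_congr rfl fun j _ => ?_
  rw [pderiv_sum _ (fun k => h5 i j k)]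
  refine Finset.sum_congr rfl fun k _ => ?_
  rw [pderiv_mul (((h4 i j k).fun_mul (h1 i)).fun_mul (h2 j)) (h2' k),
    pderiv_mul ((h4 i j k).fun_mul (h1 i)) (h2 j), pderiv_mul (h4 i j k) (h1 i),
    pderiv_comp (h3 i j k) hφs]
  change (((∑ m, _ * pderivVec a φ s m) * _ + _ * pderivVec a X s i) * _ + _ * pderivVec a Y s j)
    * _ + _ * pderivVec a Z s k = _
  simp only [← Finset.sum_mul]
  ring

end VectorCalculus

/-! ### The Gauss equation for the level surface -/

section Gauss

open Matrix

variable {U : Set (Fin 3 → ℝ)} {f : (Fin 3 → ℝ) → ℝ} {d : ℝ} {V : Set (Fin 2 → ℝ)}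
  {φ : (Fin 2 → ℝ) → (Fin 3 → ℝ)} {s : Fin 2 → ℝ}

theorem inducedMetric_hessianMetric (hV : IsOpen V) (hφ : ContDiffOn ℝ ∞ φ V) (hs : s ∈ V)
    (a b : Fin 2) :
    inducedMetric (hessianMetric d f) φ s a b =
      -1 / (d * (d - 1)) * (pderivVec a φ s ⬝ᵥ hessian f (φ s) *ᵥ pderivVec b φ s) := by
  have hφs : DifferentiableAt ℝ φ s :=
    (hφ.contDiffAt (hV.mem_nhds hs)).differentiableAt (by simp)
  rw [pderivVec_eq_fderiv hφs, pderivVec_eq_fderiv hφs, ← metricInner_hessianMetric]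
  rfl

theorem contDiffOn_hessian_form (hU : IsOpen U) (hf : ContDiffOn ℝ ∞ f U)
    (hφ : ContDiffOn ℝ ∞ φ V) (hφU : Set.MapsTo φ V U) {X Y : (Fin 2 → ℝ) → (Fin 3 → ℝ)}
    (hX : ContDiffOn ℝ ∞ X V) (hY : ContDiffOn ℝ ∞ Y V) :
    ContDiffOn ℝ ∞ (fun t => X t ⬝ᵥ hessian f (φ t) *ᵥ Y t) V := by
  simp only [dotProduct, mulVec]
  exact ContDiffOn.sum fun i _ => (contDiffOn_pi.1 hX i).mul <| ContDiffOn.sum fun j _ =>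
    ((contDiffOn_hessian hU hf i j).comp hφ hφU).mul (contDiffOn_pi.1 hY j)

theorem contDiffOn_third_form (hU : IsOpen U) (hf : ContDiffOn ℝ ∞ f U)
    (hφ : ContDiffOn ℝ ∞ φ V) (hφU : Set.MapsTo φ V U) {X Y Z : (Fin 2 → ℝ) → (Fin 3 → ℝ)}
    (hX : ContDiffOn ℝ ∞ X V) (hY : ContDiffOn ℝ ∞ Y V) (hZ : ContDiffOn ℝ ∞ Z V) :
    ContDiffOn ℝ ∞ (fun t => contractTwo (third f (φ t)) (X t) (Y t) ⬝ᵥ Z t) V := by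
  simp only [contractTwo_dotProduct]
  exact ContDiffOn.sum fun i _ => ContDiffOn.sum fun j _ => ContDiffOn.sum fun k _ =>
    ((((contDiffOn_third hU hf i j k).comp hφ hφU).mul (contDiffOn_pi.1 hX i)).mul
      (contDiffOn_pi.1 hY j)).mul (contDiffOn_pi.1 hZ k)

theorem contDiffOn_inducedMetric (hU : IsOpen U) (hf : ContDiffOn ℝ ∞ f U) (hV : IsOpen V)
    (hφ : ContDiffOn ℝ ∞ φ V) (hφU : Set.MapsTo φ V U) (a b : Fin 2) :
    ContDiffOn ℝ ∞ (fun t => inducedMetric (hessianMetric d f) φ t a b) V :=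
  (contDiffOn_const.mul (contDiffOn_hessian_form hU hf hφ hφU (contDiffOn_pderivVec hV hφ a)
    (contDiffOn_pderivVec hV hφ b))).congr fun _ hs => inducedMetric_hessianMetric hV hφ hs a b

theorem pderiv_inducedMetric (hU : IsOpen U) (hf : ContDiffOn ℝ ∞ f U) (hV : IsOpen V)
    (hφ : ContDiffOn ℝ ∞ φ V) (hφU : Set.MapsTo φ V U) (hs : s ∈ V) (a b e : Fin 2) :
    pderiv e (fun t => inducedMetric (hessianMetric d f) φ t a b) s =
      -1 / (d * (d - 1)) *
        (contractTwo (third f (φ s)) (pderivVec e φ s) (pderivVec a φ s) ⬝ᵥ pderivVec b φ s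
          + pderivVec e (pderivVec a φ) s ⬝ᵥ hessian f (φ s) *ᵥ pderivVec b φ s
          + pderivVec a φ s ⬝ᵥ hessian f (φ s) *ᵥ pderivVec e (pderivVec b φ) s) := by
  have ha := contDiffOn_pderivVec hV hφ a
  have hb := contDiffOn_pderivVec hV hφ b
  rw [eqOn_pderiv hV (fun t ht => inducedMetric_hessianMetric hV hφ ht a b) e hs,
    pderiv_const_mul (differentiableAt_of_contDiffOn hV
      (contDiffOn_hessian_form hU hf hφ hφU ha hb) hs),
    pderiv_hessian_form hU hf hV hφ hφU ha hb hs]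

/-- The right side is the inner product of the ambient covariant derivative of φ_e along φ_a with
φ_b: the induced connection is the tangential part of the ambient one. -/
theorem christoffel_inducedMetric (hU : IsOpen U) (hf : ContDiffOn ℝ ∞ f U) (hV : IsOpen V)
    (hφ : ContDiffOn ℝ ∞ φ V) (hφU : Set.MapsTo φ V U) (hs : s ∈ V) (a b e : Fin 2) :
    christoffel (inducedMetric (hessianMetric d f) φ) s a b e =
      -1 / (d * (d - 1)) *
        (pderivVec a (pderivVec e φ) s ⬝ᵥ hessian f (φ s) *ᵥ pderivVec b φ s
        + 1 / 2 * (contractTwo (third f (φ s)) (pderivVec a φ s) (pderivVec e φ s)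
          ⬝ᵥ pderivVec b φ s)) := by
  have hT := isSymmTrilinear_third hU hf (hφU hs)
  have hH := hessian_transpose hU hf (hφU hs)
  rw [christoffel, pderiv_inducedMetric hU hf hV hφ hφU hs, pderiv_inducedMetric hU hf hV hφ hφU hs,
    pderiv_inducedMetric hU hf hV hφ hφU hs, pderivVec_comm hV hφ hs e a,
    pderivVec_comm hV hφ hs e b, pderivVec_comm hV hφ hs b a,
    dotProduct_mulVec_symm hH (pderivVec b φ s),
    dotProduct_mulVec_symm hH (pderivVec a φ s) (pderivVec b (pderivVec e φ) s),
    contractTwo_dotProduct_comm hT (pderivVec e φ s) (pderivVec a φ s),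
    contractTwo_dotProduct_swap hT (pderivVec a φ s) (pderivVec b φ s),
    contractTwo_dotProduct_comm hT (pderivVec b φ s) (pderivVec a φ s),
    contractTwo_dotProduct_swap hT (pderivVec a φ s) (pderivVec b φ s)]
  ring

theorem pderiv_christoffel_inducedMetric (hU : IsOpen U) (hf : ContDiffOn ℝ ∞ f U) (hV : IsOpen V)
    (hφ : ContDiffOn ℝ ∞ φ V) (hφU : Set.MapsTo φ V U) (hs : s ∈ V) (a b e m : Fin 2) :
    pderiv m (fun t => christoffel (inducedMetric (hessianMetric d f) φ) t a b e) s =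
      -1 / (d * (d - 1)) *
        (contractTwo (third f (φ s)) (pderivVec m φ s) (pderivVec a (pderivVec e φ) s)
            ⬝ᵥ pderivVec b φ s
          + pderivVec m (pderivVec a (pderivVec e φ)) s ⬝ᵥ hessian f (φ s) *ᵥ pderivVec b φ s
          + pderivVec a (pderivVec e φ) s ⬝ᵥ hessian f (φ s) *ᵥ pderivVec m (pderivVec b φ) s
        + 1 / 2 * (∑ p, ∑ i, ∑ j, ∑ k, pderiv p (fun y => third f y i j k) (φ s) *
            pderivVec m φ s p * pderivVec a φ s i * pderivVec e φ s j * pderivVec b φ s k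
          + contractTwo (third f (φ s)) (pderivVec m (pderivVec a φ) s) (pderivVec e φ s)
            ⬝ᵥ pderivVec b φ s
          + contractTwo (third f (φ s)) (pderivVec a φ s) (pderivVec m (pderivVec e φ) s)
            ⬝ᵥ pderivVec b φ s
          + contractTwo (third f (φ s)) (pderivVec a φ s) (pderivVec e φ s)
            ⬝ᵥ pderivVec m (pderivVec b φ) s)) := by
  have ha := contDiffOn_pderivVec hV hφ a
  have hb := contDiffOn_pderivVec hV hφ b
  have he := contDiffOn_pderivVec hV hφ e
  have hae := contDiffOn_pderivVec hV he a
  have h1 := differentiableAt_of_contDiffOn hV (contDiffOn_hessian_form hU hf hφ hφU hae hb) hs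
  have h2 := differentiableAt_of_contDiffOn hV (contDiffOn_third_form hU hf hφ hφU ha he hb) hs
  rw [eqOn_pderiv hV (fun t ht => christoffel_inducedMetric hU hf hV hφ hφU ht a b e) m hs,
    pderiv_const_mul (h1.fun_add (h2.const_mul _)), pderiv_add h1 (h2.const_mul _),
    pderiv_const_mul h2, pderiv_hessian_form hU hf hV hφ hφU hae hb hs,
    pderiv_third_form hU hf hV hφ hφU ha he hb hs]

/-- The Gauss equation for a parametrized surface contained in the level set `f = 1`. -/
theorem riemann_inducedMetric (hU : IsOpen U) (hf : ContDiffOn ℝ ∞ f U)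
    (hhom : IsHomogeneousOn d f U) (hd : 2 < d) (hV : IsOpen V)
    (hφ : ContDiffOn ℝ ∞ φ V) (hφU : Set.MapsTo φ V U) (hs : s ∈ V)
    (hH : hessianDet f (φ s) ≠ 0) (hf1 : ∀ t ∈ V, f (φ t) = 1)
    (hF : IsTangentFrame (φ s) (fun i => pderiv i f (φ s)) (pderivVec 0 φ s) (pderivVec 1 φ s)) :
    riemann (inducedMetric (hessianMetric d f) φ) s 0 1 0 1 =
      -1 / (d * (d - 1)) * (-(1 / 4) *
        (dualForm (hessian f (φ s))
            (contractTwo (third f (φ s)) (pderivVec 0 φ s) (pderivVec 0 φ s))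
            (contractTwo (third f (φ s)) (pderivVec 1 φ s) (pderivVec 1 φ s))
          - dualForm (hessian f (φ s))
            (contractTwo (third f (φ s)) (pderivVec 0 φ s) (pderivVec 1 φ s))
            (contractTwo (third f (φ s)) (pderivVec 0 φ s) (pderivVec 1 φ s)))
        + d / (4 * (d - 1)) * gram (hessian f (φ s)) (pderivVec 0 φ s) (pderivVec 1 φ s)) := by
  have hJ := isHomogeneousJet hU hf hhom hH (hφU hs) (hf1 s hs)
  have hT := hJ.symm_third
  have hHs := hJ.symm_hessian
  have hd0 : d ≠ 0 := by linarith
  have hd1 : d - 1 ≠ 0 := by linarith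
  -- Differentiate f∘φ = 1 twice.
  have hgrad : ∀ a b : Fin 2, (fun i => pderiv i f (φ s)) ⬝ᵥ pderivVec a (pderivVec b φ) s =
      -(pderivVec a φ s ⬝ᵥ hessian f (φ s) *ᵥ pderivVec b φ s) := fun a b => by
    have hφd : ∀ t ∈ V, DifferentiableAt ℝ φ t := fun t ht =>
      (hφ.contDiffAt (hV.mem_nhds ht)).differentiableAt (by simp)
    have hzero : ∀ t ∈ V, pderivVec b φ t ⬝ᵥ (fun i => pderiv i f (φ t)) = 0 := fun t ht => by
      rw [dotProduct_comm, ← pderiv_comp_eq_dotProduct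
        (differentiableAt_of_contDiffOn hU hf (hφU ht)) (hφd t ht) b,
        eqOn_pderiv (G := fun _ => 1) hV (fun t ht => hf1 t ht) b ht, pderiv_const]
    have hν : ContDiffOn ℝ ∞ (fun t i => pderiv i f (φ t)) V :=
      contDiffOn_pi.2 fun i => (contDiffOn_pderiv hU hf i).comp hφ hφU
    have h := eqOn_pderiv (G := fun _ => 0) hV (fun t ht => hzero t ht) a hs
    rw [pderiv_const, pderiv_dotProduct hV (contDiffOn_pderivVec hV hφ b) hν hs] at h
    have h' : pderivVec a (fun t i => pderiv i f (φ t)) s = hessian f (φ s) *ᵥ pderivVec a φ s := by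
      ext i
      change pderiv a (fun t => pderiv i f (φ t)) s = _
      rw [pderiv_comp_eq_dotProduct (differentiableAt_of_contDiffOn hU
        (contDiffOn_pderiv hU hf i) (hφU hs)) (hφd s hs)]
      exact congrArg (· ⬝ᵥ pderivVec a φ s) (funext fun j => pderiv_comm hU hf (hφU hs) j i)
    rw [h', dotProduct_mulVec_symm hHs] at h
    rw [dotProduct_comm]
    linarith
  -- This and `h3` cancel the fourth derivatives of f and the third derivatives of φ between the two
  -- differentiated Christoffel symbols.
  have h4 : ∑ p, ∑ i, ∑ j, ∑ k, pderiv p (fun y => third f y i j k) (φ s) *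
        pderivVec 0 φ s p * pderivVec 1 φ s i * pderivVec 0 φ s j * pderivVec 1 φ s k =
      ∑ p, ∑ i, ∑ j, ∑ k, pderiv p (fun y => third f y i j k) (φ s) *
        pderivVec 1 φ s p * pderivVec 0 φ s i * pderivVec 0 φ s j * pderivVec 1 φ s k := by
    rw [Finset.sum_comm]
    refine Finset.sum_congr rfl fun i _ => Finset.sum_congr rfl fun p _ =>
      Finset.sum_congr rfl fun j _ => Finset.sum_congr rfl fun k _ => ?_
    have : pderiv p (fun y => third f y i j k) (φ s) = pderiv i (fun y => third f y p j k) (φ s) :=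
      pderiv_comm hU (contDiffOn_hessian hU hf j k) (hφU hs) p i
    rw [this]
    ring
  have h3 : pderivVec 0 (pderivVec 1 (pderivVec 0 φ)) s =
      pderivVec 1 (pderivVec 0 (pderivVec 0 φ)) s :=
    pderivVec_comm hV (contDiffOn_pderivVec hV hφ 0) hs 0 1
  have hΔ := hJ.gram_ne_zero hF
  set u := pderivVec 0 φ s with hu
  set v := pderivVec 1 φ s with hv
  set c := -1 / (d * (d - 1)) with hc
  have hc0 : c ≠ 0 := div_ne_zero (by norm_num) (mul_ne_zero hd0 hd1)
  -- The adjugate formula for the 2 × 2 inverse; the determinant c²·gram absorbs one factor c from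
  -- the entries.
  have hinv : (inducedMetric (hessianMetric d f) φ s)⁻¹ =
      (c * gram (hessian f (φ s)) u v)⁻¹ • !![v ⬝ᵥ hessian f (φ s) *ᵥ v,
        -(u ⬝ᵥ hessian f (φ s) *ᵥ v); -(u ⬝ᵥ hessian f (φ s) *ᵥ v),
        u ⬝ᵥ hessian f (φ s) *ᵥ u] := by
    apply inv_eq_right_inv
    ext a b
    rw [mul_apply, Fin.sum_univ_two]
    simp only [inducedMetric_hessianMetric hV hφ hs, ← hc]
    fin_cases a <;> fin_cases b <;> simp [← hu, ← hv, dotProduct_mulVec_symm hHs v u] <;>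
      field_simp <;> simp only [gram] <;> ring
  rw [← hJ.gauss_algebra hd hF (hgrad 0 0) (hgrad 0 1) (hgrad 1 1),
    riemann_eq_pderiv_christoffel hV (contDiffOn_inducedMetric hU hf hV hφ hφU) hs,
    pderiv_christoffel_inducedMetric hU hf hV hφ hφU hs,
    pderiv_christoffel_inducedMetric hU hf hV hφ hφU hs, h4, h3, hinv]
  simp only [christoffel_inducedMetric hU hf hV hφ hφU hs, Fin.sum_univ_two, ← hc, ← hu, ← hv,
    pderivVec_comm hV hφ hs 1 0]
  simp only [Matrix.smul_apply, smul_eq_mul, of_apply, cons_val]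
  set w₀₀ := pderivVec 0 (pderivVec 0 φ) s
  set w₀₁ := pderivVec 0 (pderivVec 1 φ) s
  set w₁₁ := pderivVec 1 (pderivVec 1 φ) s
  rw [contractTwo_dotProduct_swap hT v w₀₀ v, contractTwo_dotProduct_comm hT w₀₁ u v,
    contractTwo_dotProduct_swap hT u w₀₁ v, contractTwo_dotProduct_comm hT v u w₀₁]
  simp only [contractTwo_dotProduct_comm hT v u]
  rw [mul_inv]
  field_simp
  ring

end Gauss

/-! ### Tangent frames and curvature in dimension two -/

section Planes

open Matrix

/-- Pairing a linear relation with ν kills the coefficient of x, leaving a relation between u and v.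
-/
theorem isTangentFrame_of_linearIndependent {x ν u v : Fin 3 → ℝ} (hx : ν ⬝ᵥ x ≠ 0)
    (hu : ν ⬝ᵥ u = 0) (hv : ν ⬝ᵥ v = 0) (huv : LinearIndependent ℝ ![u, v]) :
    IsTangentFrame x ν u v := by
  refine ⟨hu, hv, fun hdet => ?_⟩
  obtain ⟨c, hc0, hc⟩ := exists_vecMul_eq_zero_iff.2 hdet
  have hsum : c 0 • u + c 1 • v + c 2 • x = 0 := by
    rw [← hc]
    ext i
    simp [vecMul, dotProduct, Fin.sum_univ_three]
  have h2 : c 2 = 0 := by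
    have := congrArg (ν ⬝ᵥ ·) hsum
    simpa [dotProduct_add, dotProduct_smul, hu, hv, hx] using this
  rw [h2, zero_smul, add_zero] at hsum
  obtain ⟨h0, h1⟩ := LinearIndependent.pair_iff.1 huv _ _ hsum
  exact hc0 (by ext i; fin_cases i <;> simp [h0, h1, h2])

/-- In two dimensions the antisymmetries leave one curvature component. Numerator and Gram
determinant both scale by the square of the determinant of (u, v). -/
theorem hasSectionalCurvature_top {g : (Fin 2 → ℝ) → Matrix (Fin 2) (Fin 2) ℝ} {s : Fin 2 → ℝ}
    (hg : (g s)ᵀ = g s) {K : ℝ} (hdet : g s 0 0 * g s 1 1 - g s 0 1 ^ 2 ≠ 0)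
    (hK : riemann g s 0 1 0 1 = K * (g s 0 0 * g s 1 1 - g s 0 1 ^ 2)) :
    HasSectionalCurvature g s ⊤ K := by
  refine ⟨by simp, fun u _ v _ huv => ?_⟩
  have hw : u 0 * v 1 - u 1 * v 0 ≠ 0 := fun h => by
    have h1 := LinearIndependent.pair_iff.1 huv (v 1) (-u 1)
      (by ext i; fin_cases i <;> simp <;> linarith)
    have h2 := LinearIndependent.pair_iff.1 huv (v 0) (-u 0)
      (by ext i; fin_cases i <;> simp <;> linarith)
    have hu : u = 0 := by ext i; fin_cases i <;> simp <;> linarith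
    exact huv.ne_zero 0 hu
  have hgram : gramDet g s u v =
      (u 0 * v 1 - u 1 * v 0) ^ 2 * (g s 0 0 * g s 1 1 - g s 0 1 ^ 2) := by
    have : g s 1 0 = g s 0 1 := congrFun (congrFun hg 0) 1
    simp only [gramDet, metricInner, Fin.sum_univ_two, this]
    ring
  have hne : gramDet g s u v ≠ 0 := hgram ▸ mul_ne_zero (pow_ne_zero 2 hw) hdet
  refine ⟨hne, ?_⟩
  have z1 : ∀ i k l, riemann g s i i k l = 0 := fun i k l => by
    have := riemann_swap_left (g := g) (s := s) i i k l
    linarith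
  have z2 : ∀ i j k, riemann g s i j k k = 0 := fun i j k => by
    have := riemann_swap_right hg i j k k
    linarith
  have r1 : riemann g s 1 0 0 1 = -riemann g s 0 1 0 1 := riemann_swap_left 0 1 0 1
  have r2 : riemann g s 0 1 1 0 = -riemann g s 0 1 0 1 := riemann_swap_right hg 0 1 0 1
  have r3 : riemann g s 1 0 1 0 = riemann g s 0 1 0 1 := by
    rw [riemann_swap_left, r2, neg_neg]
  rw [sectionalQuotient, div_eq_iff hne, hgram]
  simp only [Fin.sum_univ_two, z1, z2, r1, r2, r3, hK]
  ring

end Planes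

/-! ### Parametrization and intrinsic curvature of the level surface -/

section LevelSurface

variable {U : Set (Fin 3 → ℝ)} {f : (Fin 3 → ℝ) → ℝ} {d : ℝ} {x : Fin 3 → ℝ}

/-- The level set of a homogeneous function is parametrized locally by radial projection of an
affine plane that misses the origin. -/
theorem exists_isLocalParametrization (hU : IsOpen U) (hf : ContDiffOn ℝ ∞ f U)
    (hhom : IsHomogeneousOn d f U) (hd : 2 < d) (hx : x ∈ U) (hx1 : f x = 1) :
    ∃ V φ p, IsLocalParametrization {y ∈ U | f y = 1} x V φ p := by
  have hd0 : d ≠ 0 := by linarith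
  have hx0 : x ≠ 0 := fun h => by
    have := euler hU hf hhom hx
    rw [hx1, h] at this
    simp at this
    exact hd0 this.symm
  have he : (Pi.single 2 1 : Fin 3 → ℝ) ≠ 0 := fun h => by simpa using congrFun h 2
  -- L carries the last basis vector to x, so the affine plane where the last L-coordinate is 1
  -- passes through x = y(0) and misses the origin.
  obtain ⟨L, hL⟩ := SeparatingDual.exists_continuousLinearEquiv_apply_eq (R := ℝ) he hx0
  let y : (Fin 2 → ℝ) → (Fin 3 → ℝ) := fun s => L ![s 0, s 1, 1]
  have hy : ContDiff ℝ ∞ y := L.contDiff.comp <| contDiff_pi.2 fun i => by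
    fin_cases i
    · exact contDiff_apply ℝ ℝ 0
    · exact contDiff_apply ℝ ℝ 1
    · exact contDiff_const
  -- The scaling solves t^d f(y) = 1. Its inverse q below takes ratios of L-coordinates, which are
  -- constant on rays.
  let φ : (Fin 2 → ℝ) → (Fin 3 → ℝ) := fun s => f (y s) ^ (-1 / d) • y s
  let q : (Fin 3 → ℝ) → (Fin 2 → ℝ) := fun z => ![L.symm z 0 / L.symm z 2, L.symm z 1 / L.symm z 2]
  have hq : ContDiffOn ℝ ∞ q {z | 0 < L.symm z 2} := by
    have hc : ∀ i : Fin 3, ContDiff ℝ ∞ (fun z => L.symm z i) := fun i =>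
      (contDiff_apply ℝ ℝ i).comp L.symm.contDiff
    refine contDiffOn_pi.2 fun i => ?_
    fin_cases i
    · exact (hc 0).contDiffOn.div (hc 2).contDiffOn fun z hz => ne_of_gt hz
    · exact (hc 1).contDiffOn.div (hc 2).contDiffOn fun z hz => ne_of_gt hz
  have hO : IsOpen {z | 0 < L.symm z 2} :=
    isOpen_lt continuous_const ((continuous_apply 2).comp L.symm.continuous)
  have hV₁ : IsOpen (y ⁻¹' U) := hU.preimage hy.continuous
  have hfy : ContDiffOn ℝ ∞ (fun s => f (y s)) (y ⁻¹' U) :=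
    hf.comp hy.contDiffOn fun _ h => h
  have hV₂ : IsOpen (y ⁻¹' U ∩ (fun s => f (y s)) ⁻¹' Set.Ioi 0) :=
    hfy.continuousOn.isOpen_inter_preimage hV₁ isOpen_Ioi
  set V₂ := y ⁻¹' U ∩ (fun s => f (y s)) ⁻¹' Set.Ioi 0
  have hφ : ContDiffOn ℝ ∞ φ V₂ :=
    ((hfy.mono Set.inter_subset_left).rpow_const_of_ne fun s hs => ne_of_gt hs.2).smul
      hy.contDiffOn
  -- The rescaled point must itself lie in U, since homogeneity is known only there.
  have hV : IsOpen (V₂ ∩ φ ⁻¹' U) := hφ.continuousOn.isOpen_inter_preimage hV₂ hU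
  set V := V₂ ∩ φ ⁻¹' U
  have hpos : ∀ s ∈ V, 0 < f (y s) ^ (-1 / d) := fun s hs => Real.rpow_pos_of_pos hs.1.2 _
  have hsymm : ∀ s, L.symm (φ s) = f (y s) ^ (-1 / d) • ![s 0, s 1, 1] := fun s => by
    simp [φ, y]
  have hφO : ∀ s ∈ V, 0 < L.symm (φ s) 2 := fun s hs => by
    rw [hsymm]
    simpa using hpos s hs
  have hqφ : ∀ s ∈ V, q (φ s) = s := fun s hs => by
    have := (hpos s hs).ne'
    ext i
    simp only [q, hsymm]
    generalize f (y s) ^ (-1 / d) = t at this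
    fin_cases i <;> simp <;> field_simp
  have hφ1 : ∀ s ∈ V, f (φ s) = 1 := fun s hs => by
    have h0 : 0 < f (y s) := hs.1.2
    rw [hhom (y s) hs.1.1 _ (hpos s hs) hs.2, ← Real.rpow_mul h0.le,
      div_mul_cancel₀ _ hd0, Real.rpow_neg_one, inv_mul_cancel₀ h0.ne']
  have hφq : ∀ z ∈ U, f z = 1 → 0 < L.symm z 2 → q z ∈ V → φ (q z) = z := by
    intro z hzU hz1 hz0 hzV
    have hyq : y (q z) = (L.symm z 2)⁻¹ • z := by
      apply L.symm.injective
      ext i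
      simp only [y, q, L.symm_apply_apply, map_smul]
      fin_cases i <;> simp [hz0.ne', div_eq_inv_mul]
    have hyU : (L.symm z 2)⁻¹ • z ∈ U := hyq ▸ hzV.1.1
    have hfq : f (y (q z)) ^ (-1 / d) = L.symm z 2 := by
      rw [hyq, hhom z hzU _ (inv_pos.2 hz0) hyU, hz1, mul_one, ← Real.rpow_mul (inv_pos.2 hz0).le,
        mul_div_cancel₀ _ hd0, Real.rpow_neg_one, inv_inv]
    change f (y (q z)) ^ (-1 / d) • y (q z) = z
    rw [hfq, hyq, smul_smul, mul_inv_cancel₀ hz0.ne', one_smul]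
  have hy0 : y 0 = x := by
    rw [← hL]
    change L _ = L _
    congr 1
    ext i
    fin_cases i <;> simp
  have hφ0 : φ 0 = x := by
    simp [φ, hy0, hx1]
  have hqd : ∀ s ∈ V, ContDiffAt ℝ ∞ q (φ s) := fun s hs =>
    hq.contDiffAt (hO.mem_nhds (hφO s hs))
  have hφV : ContDiffOn ℝ ∞ φ V := hφ.mono Set.inter_subset_left
  refine ⟨V, φ, 0, hV, ⟨⟨?_, ?_⟩, ?_⟩, hφ0, hφV, fun s hs => ?_, ?_,
    U ∩ ({z | 0 < L.symm z 2} ∩ q ⁻¹' V), hU.inter (hq.continuousOn.isOpen_inter_preimage hO hV), ?_⟩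
  · change y 0 ∈ U
    rwa [hy0]
  · change 0 < f (y 0)
    rw [hy0, hx1]
    exact one_pos
  · change φ 0 ∈ U
    rwa [hφ0]
  · have h1 : HasFDerivAt φ (fderiv ℝ φ s) s :=
      ((hφV.contDiffAt (hV.mem_nhds hs)).differentiableAt (by simp)).hasFDerivAt
    have h2 : HasFDerivAt q (fderiv ℝ q (φ s)) (φ s) :=
      ((hqd s hs).differentiableAt (by simp)).hasFDerivAt
    -- The smooth left inverse q makes φ an immersion; its continuity gives the embedding below.
    have h3 : q ∘ φ =ᶠ[nhds s] id := Filter.eventuallyEq_of_mem (hV.mem_nhds hs) hqφ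
    have h4 := (h2.comp s h1).unique ((hasFDerivAt_id s).congr_of_eventuallyEq h3)
    exact Function.LeftInverse.injective (g := fderiv ℝ q (φ s)) fun w => by
      simpa using DFunLike.congr_fun h4 w
  · refine ⟨Topology.isInducing_iff_nhds.2 fun s => le_antisymm ?_ ?_, fun s t hst => ?_⟩
    · exact Filter.tendsto_iff_comap.1
        (continuousOn_iff_continuous_domRestrict.1 hφV.continuousOn).continuousAt
    · have hc : Filter.Tendsto q (nhds (φ s)) (nhds (s : Fin 2 → ℝ)) := by
        have := (hqd s s.2).continuousAt.tendsto
        rwa [hqφ s s.2] at this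
      rw [nhds_subtype_eq_comap]
      calc Filter.comap (V.domRestrict φ) (nhds (φ s))
          ≤ Filter.comap (V.domRestrict φ) (Filter.comap q (nhds (s : Fin 2 → ℝ))) :=
            Filter.comap_mono (Filter.tendsto_iff_comap.1 hc)
        _ = Filter.comap Subtype.val (nhds (s : Fin 2 → ℝ)) := by
            rw [Filter.comap_comap]
            congr 1
            funext t
            exact hqφ t t.2
    · have h : φ s = φ t := hst
      apply Subtype.ext
      rw [← hqφ s s.2, ← hqφ t t.2, h]
  · ext z
    constructor
    · rintro ⟨s, hs, rfl⟩
      refine ⟨⟨hs.2, hφ1 s hs⟩, hs.2, hφO s hs, ?_⟩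
      change q (φ s) ∈ V
      rwa [hqφ s hs]
    · rintro ⟨⟨hzU, hz1⟩, -, hz0, hzV⟩
      exact ⟨q z, hzV, hφq z hzU hz1 hz0 hzV⟩

/-- Dividing `riemann_inducedMetric` by c²·gram, the Q term gives the ambient curvature and the
other gives c⁻¹d/(4(d-1)) = -d²/4. -/
theorem hasSectionalCurvature_inducedMetric (hU : IsOpen U) (hf : ContDiffOn ℝ ∞ f U)
    (hhom : IsHomogeneousOn d f U) (hH : hessianDet f x ≠ 0) (hd : 2 < d) (hx : x ∈ U)
    (hx1 : f x = 1) {V : Set (Fin 2 → ℝ)} {φ : (Fin 2 → ℝ) → (Fin 3 → ℝ)} {p : Fin 2 → ℝ}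
    (hφ : IsLocalParametrization {y ∈ U | f y = 1} x V φ p) :
    HasSectionalCurvature (inducedMetric (hessianMetric d f) φ) p ⊤
      (-(d ^ 2 / 4) + d ^ 2 * (d - 1) ^ 2 / (4 * (d - 2) ^ 2) *
        (clebsch f x / hessianDet f x ^ 2)) := by
  obtain ⟨hV, hp, rfl, hsm, himm, -, W, -, hW⟩ := hφ
  have hM : ∀ s ∈ V, φ s ∈ U ∧ f (φ s) = 1 := fun s hs =>
    (hW ▸ Set.mem_image_of_mem φ hs : φ s ∈ {y ∈ U | f y = 1} ∩ W).1
  have hφU : Set.MapsTo φ V U := fun s hs => (hM s hs).1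
  have hφp : DifferentiableAt ℝ φ p :=
    (hsm.contDiffAt (hV.mem_nhds hp)).differentiableAt (by simp)
  have hJ := isHomogeneousJet hU hf hhom hH hx hx1
  have hd0 : d ≠ 0 := by linarith
  have hd1 : d - 1 ≠ 0 := by linarith
  have hd2 : d - 2 ≠ 0 := by linarith
  have htan : ∀ a, (fun i => pderiv i f (φ p)) ⬝ᵥ pderivVec a φ p = 0 := fun a => by
    rw [← pderiv_comp_eq_dotProduct (differentiableAt_of_contDiffOn hU hf hx) hφp a,
      eqOn_pderiv (G := fun _ => 1) hV (fun t ht => (hM t ht).2) a hp, pderiv_const]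
  have hli : LinearIndependent ℝ ![pderivVec 0 φ p, pderivVec 1 φ p] := by
    rw [LinearIndependent.pair_iff]
    intro a b hab
    rw [pderivVec_eq_fderiv hφp, pderivVec_eq_fderiv hφp, ← map_smul, ← map_smul, ← map_add] at hab
    have h0 := himm p hp (hab.trans (map_zero _).symm)
    exact ⟨by simpa using congrFun h0 0, by simpa using congrFun h0 1⟩
  have hF := isTangentFrame_of_linearIndependent (by rw [hJ.euler_grad]; exact hd0)
    (htan 0) (htan 1) hli
  have hΔ := hJ.gram_ne_zero hF
  have hc : -1 / (d * (d - 1)) ≠ 0 := div_ne_zero (by norm_num) (mul_ne_zero hd0 hd1)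
  have hG := inducedMetric_hessianMetric (d := d) (f := f) hV hsm hp
  have hdet : inducedMetric (hessianMetric d f) φ p 0 0 * inducedMetric (hessianMetric d f) φ p 1 1
      - inducedMetric (hessianMetric d f) φ p 0 1 ^ 2 = (-1 / (d * (d - 1))) ^ 2 *
        gram (hessian f (φ p)) (pderivVec 0 φ p) (pderivVec 1 φ p) := by
    simp only [hG, gram]
    ring
  apply hasSectionalCurvature_top
  · ext a b
    rw [Matrix.transpose_apply, hG, hG, dotProduct_mulVec_symm hJ.symm_hessian]
  · rw [hdet]
    exact mul_ne_zero (pow_ne_zero 2 hc) hΔ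
  · have hQ := hJ.dualForm_sub_div_gram hd hF
    rw [div_eq_iff hΔ] at hQ
    rw [hdet, riemann_inducedMetric hU hf hhom hd hV hsm hφU hp hH (fun t ht => (hM t ht).2) hF,
      hQ, clebsch_eq_aronhold, hessianDet]
    have := hJ.det_ne_zero
    field_simp
    ring

end LevelSurface

end HessianCurv

/-! ### The two curvature formulas -/

open HessianCurv
theorem theorem3p1 (d : ℝ) (hd : 2 < d) (U : Set (Fin 3 → ℝ)) (hU : IsOpen U)
    (f : (Fin 3 → ℝ) → ℝ) (hf : ContDiffOn ℝ ∞ f U) (hhom : IsHomogeneousOn d f U)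
    (hH : ∀ x ∈ U, hessianDet f x ≠ 0) (x : Fin 3 → ℝ) (hx : x ∈ U) (hx1 : f x = 1) :
    HasSectionalCurvature (hessianMetric d f) x (LinearMap.ker (fderiv ℝ f x).toLinearMap)
        (d ^ 2 * (d - 1) ^ 2 / (4 * (d - 2) ^ 2) * (clebsch f x * f x / hessianDet f x ^ 2)) ∧
      HasSurfaceCurvature (hessianMetric d f) {y ∈ U | f y = 1} x
        (-(d ^ 2 / 4) + d ^ 2 * (d - 1) ^ 2 / (4 * (d - 2) ^ 2) *
          (clebsch f x * f x ^ 2 / hessianDet f x ^ 2)) := by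
  have hJ := isHomogeneousJet hU hf hhom (hH x hx) hx hx1
  have hd0 : d ≠ 0 := by linarith
  have hν : ∀ w, (fun i => pderiv i f x) ⬝ᵥ w = fderiv ℝ f x w := fun w =>
    (fderiv_eq_sum_pderiv x w).symm
  -- Since df(x) = d ≠ 0, the kernel has dimension two.
  have hsurj : Function.Surjective (fderiv ℝ f x).toLinearMap := by
    apply LinearMap.surjective
    intro h
    have h1 := hJ.euler_grad
    rw [hν] at h1
    exact hd0 (h1.symm.trans (LinearMap.congr_fun h x))
  rw [hx1, one_pow, mul_one]
  refine ⟨⟨?_, fun u hu v hv huv => ?_⟩,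
    exists_isLocalParametrization hU hf hhom hd hx hx1, fun V φ p hφ =>
    hasSectionalCurvature_inducedMetric hU hf hhom (hH x hx) hd hx hx1 hφ⟩
  · have h := LinearMap.finrank_range_add_finrank_ker (fderiv ℝ f x).toLinearMap
    rw [LinearMap.range_eq_top.2 hsurj, finrank_top, Module.finrank_self,
      Module.finrank_fin_fun] at h
    omega
  · exact sectionalQuotient_hessianMetric hU hf hhom (hH x hx) hd hx hx1
      (isTangentFrame_of_linearIndependent (by rw [hJ.euler_grad]; exact hd0)
        ((hν u).trans hu) ((hν v).trans hv) huv)
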